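/- Let $m,n\ge 0$ be integers. Let $\mathbb C^{2m+1|2n}$ be the complex superspace with basis $v_r, v_{\bar r}$ ($r\in I=\{-m,\dots,-1\}\cup\{\tfrac12,\tfrac32,\dots,n-\tfrac12\}$) and $v_{\bar 0}$, where $v_r,v_{\bar r}$ are even for $r\in\mathbb Z$ and odd for $r\in\tfrac12+\mathbb Z$, and $v_{\bar 0}$ is even, equipped with the supersymmetric bilinear form given by $(v_r|v_{\bar s})=\delta_{rs}=(-1)^{|v_r||v_s|}(v_{\bar s}|v_r)$, $(v_{\bar0}|v_{\bar0})=1$, all other values on basis vectors being $0$. Let $\mathfrak{osp}(2m+1|2n)$ be the Lie superalgebra of endomorphisms preserving this form, with Cartan subalgebra spanned by $E_r=E_{rr}-E_{\bar r\bar r}$ ($r\in I$) and dual basis $\{\epsilon_r\}_{r\in I}$. A weight is called integral if it lies in $\sum_{r\in I}\mathbb Z\epsilon_r$. Let $\mathfrak b$ be the Borel subalgebra of matrices in $\mathfrak{osp}(2m+1|2n)$ that are upper triangular with respect to the order $$\overline{n-\tfrac12}<\dots<\overline{\tfrac12}<\overline{-1}<\dots<\overline{-m}<\bar0<-m<\dots<-1<\tfrac12<\dots<n-\tfrac12$$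 of the basis; for $m,n\ge1$ its simple roots are $-\epsilon_{-m}$, $\epsilon_{j}-\epsilon_{j+1}$ ($-m\le j\le -2$), $\epsilon_{-1}-\epsilon_{1/2}$, and $\epsilon_{i-1/2}-\epsilon_{i+1/2}$ ($1\le i\le n-1$). Let $V$ be an irreducible ($\mathbb Z_2$-graded) $\mathfrak{osp}(2m+1|2n)$-module with highest weight $\mu$ with respect to $\mathfrak b$, and suppose that $\mu$ is integral. Then $V$ is finite dimensional if and only if $$\mu=-\sum_{j=1}^{m}\max\{\lambda'_j-n,0\}\,\epsilon_{-j}-\sum_{i=1}^{n}\lambda_{n-i+1}\,\epsilon_{i-1/2}$$ for some $(n|m)$-hook partition $\lambda=(\lambda_1\ge\lambda_2\ge\cdots)$, that is, a partition with $\lambda_{n+1}\le m$; here $\lambda'$ denotes the conjugate partition. -/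

import Mathlib

namespace OSP

/-- The sign `(-1)^a` of a parity `a`. -/
def sgn (a : ZMod 2) : ℂ := if a = 0 then 1 else -1

theorem sgn_add (a b : ZMod 2) : sgn (a + b) = sgn a * sgn b := by
  have h : ∀ c : ZMod 2, c = 0 ∨ c = 1 := by decide
  have h2 : (1 + 1 : ZMod 2) = 0 := by decide
  rcases h a with rfl | rfl <;> rcases h b with rfl | rfl <;> simp [sgn, h2]

theorem sgn_mul_self (a : ZMod 2) : sgn a * sgn a = 1 := by
  unfold sgn; split_ifs <;> norm_num

/-- The labels `-m, …, -1, 1/2, 3/2, …, n - 1/2`: `Sum.inl j` is the label `-(j+1)` and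
`Sum.inr i` is the label `i + 1/2`, with `j < m` and `i < n` counted from `0`. -/
abbrev PIdx (m n : ℕ) : Type := Fin m ⊕ Fin n

/-- The indices of the standard basis of the natural module `ℂ^{2m+1|2n}`:
a barred label, the index `0`, or an unbarred label. -/
abbrev Idx (m n : ℕ) : Type := PIdx m n ⊕ (Unit ⊕ PIdx m n)

/-- The basis index with a bar. -/
abbrev barIdx {m n : ℕ} (r : PIdx m n) : Idx m n := Sum.inl r

/-- The basis index `0`. -/
abbrev zeroIdx {m n : ℕ} : Idx m n := Sum.inr (Sum.inl ())

/-- The basis index without a bar. -/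
abbrev posIdx {m n : ℕ} (r : PIdx m n) : Idx m n := Sum.inr (Sum.inr r)

/-- The parity of a label: integral labels are even, half-integral labels are odd. -/
def pparity {m n : ℕ} : PIdx m n → ZMod 2
  | Sum.inl _ => 0
  | Sum.inr _ => 1

/-- The parity of the basis vectors of the natural module. -/
def parity {m n : ℕ} : Idx m n → ZMod 2
  | Sum.inl r => pparity r
  | Sum.inr (Sum.inl _) => 0
  | Sum.inr (Sum.inr r) => pparity r

/-- The place of a label in the order `-m < … < -1 < 1/2 < … < n - 1/2`, counted from `1`. -/
def level {m n : ℕ} : PIdx m n → ℤ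
  | Sum.inl j => (m : ℤ) - (j : ℕ)
  | Sum.inr i => (m : ℤ) + (i : ℕ) + 1

/-- The place of a basis index in the total order in which the barred labels come first, in
reverse order, then `0`, then the unbarred labels. -/
def place {m n : ℕ} : Idx m n → ℤ
  | Sum.inl r => -level r
  | Sum.inr (Sum.inl _) => 0
  | Sum.inr (Sum.inr r) => level r

/-- The Gram matrix of the supersymmetric form on the natural module:
`(v_r | v_{bar s}) = δ_{rs} = (-1)^{|r||s|} (v_{bar s} | v_r)`, `(v_0 | v_0) = 1`,
all other values being zero. -/
def gram (m n : ℕ) : Matrix (Idx m n) (Idx m n) ℂ := Matrix.of fun i j =>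
  match i, j with
  | Sum.inr (Sum.inr r), Sum.inl s => if r = s then 1 else 0
  | Sum.inl s, Sum.inr (Sum.inr r) => if r = s then sgn (pparity r * pparity s) else 0
  | Sum.inr (Sum.inl _), Sum.inr (Sum.inl _) => 1
  | _, _ => 0

/-- The part of degree `a` of the general linear Lie superalgebra `gl(2m+1|2n)`. -/
def glPart (m n : ℕ) (a : ZMod 2) : Submodule ℂ (Matrix (Idx m n) (Idx m n) ℂ) where
  carrier := {A | ∀ i j, parity i + parity j ≠ a → A i j = 0}
  add_mem' := by
    intro A B hA hB i j h
    simp [hA i j h, hB i j h]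
  zero_mem' := by
    intro i j _
    rfl
  smul_mem' := by
    intro c A hA i j h
    simp [hA i j h]

/-- The supercommutator on `gl(2m+1|2n)`, the bilinear extension of
`[A, B] = AB - (-1)^{|A||B|} BA`. -/
def superBracket {m n : ℕ} (A B : Matrix (Idx m n) (Idx m n) ℂ) :
    Matrix (Idx m n) (Idx m n) ℂ := Matrix.of fun i j =>
  ∑ k, (A i k * B k j
    - sgn ((parity i + parity k) * (parity k + parity j)) * (B i k * A k j))

theorem superBracket_of_mem {m n : ℕ} {a b : ZMod 2} {A B : Matrix (Idx m n) (Idx m n) ℂ}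
    (hA : A ∈ glPart m n a) (hB : B ∈ glPart m n b) :
    superBracket A B = A * B - sgn (a * b) • (B * A) := by
  ext i j
  simp only [superBracket, Matrix.of_apply, Matrix.sub_apply, Matrix.smul_apply, Matrix.mul_apply, smul_eq_mul,
    Finset.mul_sum, ← Finset.sum_sub_distrib]
  refine Finset.sum_congr rfl fun k _ => ?_
  by_cases h1 : parity i + parity k = b
  · by_cases h2 : parity k + parity j = a
    · rw [h1, h2, mul_comm b a]
    · simp [hA k j h2]
  · simp [hB i k h1]

/-- The orthosymplectic Lie superalgebra `osp(2m+1|2n)`, as a subspace of `gl(2m+1|2n)`.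
The condition says `(A v_j | v_k) + (-1)^{|A||v_j|} (v_j | A v_k) = 0`: only the component of `A`
of degree `|v_j| + |v_k|` contributes to it, because the form is even. -/
def osp (m n : ℕ) : Submodule ℂ (Matrix (Idx m n) (Idx m n) ℂ) where
  carrier := {A | ∀ j k, (A.transpose * gram m n) j k
    + sgn ((parity j + parity k) * parity j) * (gram m n * A) j k = 0}
  add_mem' := by
    intro A B hA hB j k
    have h1 := hA j k
    have h2 := hB j k
    simp only [Matrix.transpose_add, Matrix.add_mul, Matrix.mul_add, Matrix.add_apply]
    linear_combination h1 + h2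
  zero_mem' := by
    intro j k
    simp
  smul_mem' := by
    intro c A hA j k
    have h1 := hA j k
    simp only [Matrix.transpose_smul, Matrix.smul_mul, Matrix.mul_smul, Matrix.smul_apply,
      smul_eq_mul]
    linear_combination c * h1

theorem gram_even {m n : ℕ} (i j : Idx m n) (h : parity i ≠ parity j) : gram m n i j = 0 := by
  rcases i with r | u | r <;> rcases j with s | w | s <;> simp only [gram, Matrix.of_apply] <;>
    first
      | rfl
      | (split_ifs with hrs
         · subst hrs; exact absurd rfl h
         · rfl)
      | exact absurd rfl h

theorem zmod_two_eq_add {x y a : ZMod 2} (h : x + y = a) : x = y + a := by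
  subst h
  revert x y
  decide

/-- The diagonal matrix of the signs `(-1)^{a|v_j|}`. -/
def signMatrix (m n : ℕ) (a : ZMod 2) : Matrix (Idx m n) (Idx m n) ℂ :=
  Matrix.diagonal fun j => sgn (a * parity j)

theorem mem_osp_iff_of_mem {m n : ℕ} {a : ZMod 2} {A : Matrix (Idx m n) (Idx m n) ℂ}
    (hA : A ∈ glPart m n a) :
    A ∈ osp m n ↔ A.transpose * gram m n = -(signMatrix m n a * (gram m n * A)) := by
  have key : ∀ j k, sgn ((parity j + parity k) * parity j) * (gram m n * A) j k
      = (signMatrix m n a * (gram m n * A)) j k := by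
    intro j k
    rw [signMatrix, Matrix.diagonal_mul]
    by_cases h : parity j + parity k = a
    · rw [h]
    · have h0 : (gram m n * A) j k = 0 := by
        rw [Matrix.mul_apply]
        refine Finset.sum_eq_zero fun i _ => ?_
        by_cases h1 : parity j = parity i
        · rw [hA i k (by rwa [← h1]), mul_zero]
        · rw [gram_even j i h1, zero_mul]
      rw [h0, mul_zero, mul_zero]
  constructor
  · intro h
    ext j k
    rw [Matrix.neg_apply, ← key]
    exact eq_neg_of_add_eq_zero_left (h j k)
  · intro h j k
    rw [key, h, Matrix.neg_apply, neg_add_cancel]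

/-- The homogeneous component of degree `a`. -/
def component {m n : ℕ} (a : ZMod 2) (A : Matrix (Idx m n) (Idx m n) ℂ) :
    Matrix (Idx m n) (Idx m n) ℂ :=
  Matrix.of fun i j => if parity i + parity j = a then A i j else 0

theorem component_mem {m n : ℕ} (a : ZMod 2) (A : Matrix (Idx m n) (Idx m n) ℂ) :
    component a A ∈ glPart m n a := by
  intro i j h
  simp [component, h]

theorem component_add {m n : ℕ} (A : Matrix (Idx m n) (Idx m n) ℂ) :
    component 0 A + component 1 A = A := by
  ext i j
  simp only [component, Matrix.add_apply, Matrix.of_apply]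
  generalize parity i + parity j = x
  have h : ∀ c : ZMod 2, c = 0 ∨ c = 1 := by decide
  rcases h x with rfl | rfl <;> simp

theorem component_mem_osp {m n : ℕ} (a : ZMod 2) {A : Matrix (Idx m n) (Idx m n) ℂ}
    (hA : A ∈ osp m n) : component a A ∈ osp m n := by
  intro j k
  have e1 : ((component a A).transpose * gram m n) j k
      = if parity j + parity k = a then (A.transpose * gram m n) j k else 0 := by
    have e : ∀ i, (component a A).transpose j i * gram m n i k
        = if parity j + parity k = a then A.transpose j i * gram m n i k else 0 := by
      intro i
      simp only [Matrix.transpose_apply, component, Matrix.of_apply]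
      by_cases h : parity i = parity k
      · rw [h, add_comm (parity k)]
        split_ifs <;> simp
      · rw [gram_even i k h]
        simp
    simp only [Matrix.mul_apply, e]
    split_ifs <;> simp
  have e2 : (gram m n * component a A) j k
      = if parity j + parity k = a then (gram m n * A) j k else 0 := by
    have e : ∀ i, gram m n j i * component a A i k
        = if parity j + parity k = a then gram m n j i * A i k else 0 := by
      intro i
      simp only [component, Matrix.of_apply]
      by_cases h : parity j = parity i
      · rw [h]
        split_ifs <;> simp
      · rw [gram_even j i h]
        simp
    simp only [Matrix.mul_apply, e]
    split_ifs <;> simp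
  rw [e1, e2]
  have := hA j k
  split_ifs
  · exact this
  · simp

theorem mul_mem_glPart {m n : ℕ} {a b : ZMod 2} {A B : Matrix (Idx m n) (Idx m n) ℂ}
    (hA : A ∈ glPart m n a) (hB : B ∈ glPart m n b) : A * B ∈ glPart m n (a + b) := by
  intro i j h
  rw [Matrix.mul_apply]
  refine Finset.sum_eq_zero fun k _ => ?_
  by_cases h1 : parity i + parity k = a
  · by_cases h2 : parity k + parity j = b
    · refine absurd ?_ h
      rw [← h1, ← h2]
      have h3 : ∀ x y z : ZMod 2, x + z = x + y + (y + z) := by decide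
      exact h3 _ _ _
    · rw [hB k j h2, mul_zero]
  · rw [hA i k h1, zero_mul]

theorem superBracket_mem_glPart {m n : ℕ} {a b : ZMod 2} {A B : Matrix (Idx m n) (Idx m n) ℂ}
    (hA : A ∈ glPart m n a) (hB : B ∈ glPart m n b) : superBracket A B ∈ glPart m n (a + b) := by
  rw [superBracket_of_mem hA hB]
  refine Submodule.sub_mem _ (mul_mem_glPart hA hB) (Submodule.smul_mem _ _ ?_)
  rw [add_comm]
  exact mul_mem_glPart hB hA

theorem signMatrix_mul (m n : ℕ) (a b : ZMod 2) :
    signMatrix m n a * signMatrix m n b = signMatrix m n (a + b) := by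
  simp only [signMatrix, Matrix.diagonal_mul_diagonal, add_mul, sgn_add]

theorem transpose_mul_signMatrix {m n : ℕ} (a : ZMod 2) {b : ZMod 2}
    {B : Matrix (Idx m n) (Idx m n) ℂ} (hB : B ∈ glPart m n b) :
    B.transpose * signMatrix m n a = sgn (a * b) • (signMatrix m n a * B.transpose) := by
  ext j k
  simp only [signMatrix, Matrix.mul_diagonal, Matrix.smul_apply, Matrix.diagonal_mul,
    Matrix.transpose_apply, smul_eq_mul]
  by_cases h : parity k + parity j = b
  · rw [zmod_two_eq_add h, mul_add, sgn_add]
    ring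
  · rw [hB k j h]
    simp

theorem superBracket_mem_of_mem {m n : ℕ} {a b : ZMod 2} {A B : Matrix (Idx m n) (Idx m n) ℂ}
    (hA : A ∈ glPart m n a) (hB : B ∈ glPart m n b) (hA' : A ∈ osp m n) (hB' : B ∈ osp m n) :
    superBracket A B ∈ osp m n := by
  rw [mem_osp_iff_of_mem (superBracket_mem_glPart hA hB), superBracket_of_mem hA hB]
  rw [mem_osp_iff_of_mem hA] at hA'
  rw [mem_osp_iff_of_mem hB] at hB'
  have e1 : B.transpose * A.transpose * gram m n
      = sgn (a * b) • (signMatrix m n (a + b) * (gram m n * (B * A))) := by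
    calc B.transpose * A.transpose * gram m n
        = -(B.transpose * signMatrix m n a * (gram m n * A)) := by
          rw [Matrix.mul_assoc, hA', Matrix.mul_neg, Matrix.mul_assoc]
      _ = -(sgn (a * b) • (signMatrix m n a * ((B.transpose * gram m n) * A))) := by
          rw [transpose_mul_signMatrix a hB, Matrix.smul_mul]
          simp only [Matrix.mul_assoc]
      _ = sgn (a * b) • (signMatrix m n (a + b) * (gram m n * (B * A))) := by
          rw [hB', ← signMatrix_mul]
          simp only [Matrix.mul_assoc, Matrix.neg_mul, Matrix.mul_neg, smul_neg, neg_neg]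
  have e2 : A.transpose * B.transpose * gram m n
      = sgn (a * b) • (signMatrix m n (a + b) * (gram m n * (A * B))) := by
    calc A.transpose * B.transpose * gram m n
        = -(A.transpose * signMatrix m n b * (gram m n * B)) := by
          rw [Matrix.mul_assoc, hB', Matrix.mul_neg, Matrix.mul_assoc]
      _ = -(sgn (a * b) • (signMatrix m n b * ((A.transpose * gram m n) * B))) := by
          rw [transpose_mul_signMatrix b hA, Matrix.smul_mul, mul_comm b a]
          simp only [Matrix.mul_assoc]
      _ = sgn (a * b) • (signMatrix m n (a + b) * (gram m n * (A * B))) := by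
          rw [hA', add_comm a b, ← signMatrix_mul]
          simp only [Matrix.mul_assoc, Matrix.neg_mul, Matrix.mul_neg, smul_neg, neg_neg]
  rw [Matrix.transpose_sub, Matrix.transpose_smul, Matrix.transpose_mul, Matrix.transpose_mul,
    Matrix.sub_mul, Matrix.smul_mul, e1, e2, smul_smul, sgn_mul_self, one_smul, Matrix.mul_sub,
    Matrix.mul_sub, Matrix.mul_smul, Matrix.mul_smul]
  abel

theorem superBracket_add_left {m n : ℕ} (A A' B : Matrix (Idx m n) (Idx m n) ℂ) :
    superBracket (A + A') B = superBracket A B + superBracket A' B := by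
  ext i j
  simp only [superBracket, Matrix.of_apply, Matrix.add_apply, ← Finset.sum_add_distrib]
  exact Finset.sum_congr rfl fun k _ => by ring

theorem superBracket_add_right {m n : ℕ} (A B B' : Matrix (Idx m n) (Idx m n) ℂ) :
    superBracket A (B + B') = superBracket A B + superBracket A B' := by
  ext i j
  simp only [superBracket, Matrix.of_apply, Matrix.add_apply, ← Finset.sum_add_distrib]
  exact Finset.sum_congr rfl fun k _ => by ring

/-- The orthosymplectic Lie superalgebra is closed under the supercommutator. -/
theorem superBracket_mem {m n : ℕ} {A B : Matrix (Idx m n) (Idx m n) ℂ}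
    (hA : A ∈ osp m n) (hB : B ∈ osp m n) : superBracket A B ∈ osp m n := by
  have key : ∀ a b, superBracket (component a A) (component b B) ∈ osp m n := fun a b =>
    superBracket_mem_of_mem (component_mem a A) (component_mem b B)
      (component_mem_osp a hA) (component_mem_osp b hB)
  rw [← component_add A, ← component_add B, superBracket_add_left, superBracket_add_right,
    superBracket_add_right]
  exact Submodule.add_mem _ (Submodule.add_mem _ (key 0 0) (key 0 1))
    (Submodule.add_mem _ (key 1 0) (key 1 1))

/-- The Lie superbracket of `osp(2m+1|2n)`. -/
def bracket {m n : ℕ} (x y : osp m n) : osp m n :=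
  ⟨superBracket x.1 y.1, superBracket_mem x.2 y.2⟩

/-- A module over the Lie superalgebra `osp(2m+1|2n)`: a complex super vector space with an
even linear action that is compatible with the superbracket. -/
structure OspModule (m n : ℕ) (V : Type*) [AddCommGroup V] [Module ℂ V] where
  /-- the even part (`0`) and the odd part (`1`) -/
  part : ZMod 2 → Submodule ℂ V
  isCompl : IsCompl (part 0) (part 1)
  /-- the action -/
  act : osp m n →ₗ[ℂ] Module.End ℂ V
  act_mem : ∀ (a b : ZMod 2) (x : osp m n) (v : V),
    x.1 ∈ glPart m n a → v ∈ part b → act x v ∈ part (a + b)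
  act_bracket : ∀ (a b : ZMod 2) (x y : osp m n),
    x.1 ∈ glPart m n a → y.1 ∈ glPart m n b →
      act (bracket x y) = act x * act y - sgn (a * b) • (act y * act x)

/-- Irreducibility: the module is non-zero, and its only submodules (graded subspaces that are
stable under the action) are zero and the whole module. -/
def OspModule.IsIrreducible {m n : ℕ} {V : Type*} [AddCommGroup V] [Module ℂ V]
    (M : OspModule m n V) : Prop :=
  Nontrivial V ∧ ∀ W : Submodule ℂ V,
    W = (W ⊓ M.part 0) ⊔ (W ⊓ M.part 1) →
    (∀ (x : osp m n), ∀ w ∈ W, M.act x w ∈ W) → W = ⊥ ∨ W = ⊤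

/-- The standard Cartan subalgebra: the diagonal matrices in `osp(2m+1|2n)`. -/
def cartan (m n : ℕ) : Submodule ℂ (osp m n) where
  carrier := {x | ∀ i j, i ≠ j → x.1 i j = 0}
  add_mem' := by
    intro x y hx hy i j h
    simp [hx i j h, hy i j h]
  zero_mem' := by
    intro i j _
    rfl
  smul_mem' := by
    intro c x hx i j h
    simp [hx i j h]

/-- The nilradical of the Borel subalgebra: the strictly upper triangular matrices in
`osp(2m+1|2n)`. Its roots are `±ε_r - ε_s` for `r < s`, `-ε_r`, and `-2ε_s` for half-integral `s`,
so that the Borel subalgebra has the simple roots `-ε_{-m}`, `ε_{-m} - ε_{-m+1}`, …,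
`ε_{-2} - ε_{-1}`, `ε_{-1} - ε_{1/2}`, `ε_{1/2} - ε_{3/2}`, …, `ε_{n-3/2} - ε_{n-1/2}`. -/
def nilradical (m n : ℕ) : Submodule ℂ (osp m n) where
  carrier := {x | ∀ i j, ¬ place i < place j → x.1 i j = 0}
  add_mem' := by
    intro x y hx hy i j h
    simp [hx i j h, hy i j h]
  zero_mem' := by
    intro i j _
    rfl
  smul_mem' := by
    intro c x hx i j h
    simp [hx i j h]

/-- The weight `ε_r`, which reads off the diagonal entry at the label `r`. -/
def eps {m n : ℕ} (r : PIdx m n) : Module.Dual ℂ (cartan m n) where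
  toFun x := x.1.1 (posIdx r) (posIdx r)
  map_add' _ _ := rfl
  map_smul' _ _ := rfl

/-- The weight `ε_{-(j+1)}`. -/
abbrev epsInt (m n : ℕ) (j : Fin m) : Module.Dual ℂ (cartan m n) := eps (Sum.inl j)

/-- The weight `ε_{i+1/2}`. -/
abbrev epsHalf (m n : ℕ) (i : Fin n) : Module.Dual ℂ (cartan m n) := eps (Sum.inr i)

/-- Integral weights: the elements of the `ℤ`-span of the `ε_r`. -/
def IsIntegralWeight {m n : ℕ} (μ : Module.Dual ℂ (cartan m n)) : Prop :=
  μ ∈ AddSubgroup.closure (Set.range (eps : PIdx m n → Module.Dual ℂ (cartan m n)))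

/-- The module has a highest weight vector of weight `μ`: a non-zero vector that is annihilated
by the nilradical of the Borel subalgebra and on which the Cartan subalgebra acts through `μ`. -/
def OspModule.HasHighestWeight {m n : ℕ} {V : Type*} [AddCommGroup V] [Module ℂ V]
    (M : OspModule m n V) (μ : Module.Dual ℂ (cartan m n)) : Prop :=
  ∃ v : V, v ≠ 0 ∧ (∀ x ∈ nilradical m n, M.act x v = 0) ∧
    ∀ h : cartan m n, M.act h.1 v = μ h • v

/-- The `(n|m)`-hook partitions: the partitions with `λ_{n+1} ≤ m`. Rows and columns of a Young
diagram are counted from `0`. -/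
def IsHookPartition (n m : ℕ) (lam : YoungDiagram) : Prop := lam.rowLen n ≤ m

/-- The weight `-∑_{j=1}^m max(λ'_j - n, 0) ε_{-j} - ∑_{i=1}^n λ_{n-i+1} ε_{i-1/2}`. -/
noncomputable def hookWeight (m n : ℕ) (lam : YoungDiagram) : Module.Dual ℂ (cartan m n) :=
  - ∑ j : Fin m, (max ((lam.colLen j : ℤ) - (n : ℤ)) 0) • epsInt m n j
  - ∑ i : Fin n, (lam.rowLen (n - 1 - (i : ℕ)) : ℤ) • epsHalf m n i

end OSP

/-! Write `μ = -∑ a_r ε_r`. Both sides of the equivalence amount to `IsDominant a`: `0 ≤ a_{1/2} ≤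
a_{3/2} ≤ …`, `a_{-1} ≥ a_{-2} ≥ … ≥ 0`, and `a_{-j} = 0` whenever `a_{1/2} < j`. Combinatorially,
the half-integral coefficients are the first `n` rows of a diagram, the integral ones are the
columns of what lies below row `n`, and the last condition says that the lower piece fits under the
upper one (`isDominant_iff_exists_youngDiagram`).

Necessity: `sl_2`-theory for even roots gives every inequality except the last. For that one, odd
reflections (`odd_reflection`) move the label `1/2` below all integral labels. Each lowers the
coefficient at `1/2` by one, unless the two coefficients involved add up to zero. The final
coefficient must again be nonnegative, which forces the last condition
(`eq_zero_of_reflSeq_nonneg`); `reflSeq_nonneg` is the converse.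

Sufficiency: in an irreducible module a singular vector strictly below the highest weight vector is
zero (`eq_zero_of_isSing`). Hence a high power of the lowering operator of each even simple root
kills the highest weight vector. The root `-ε_{1/2}` is treated in the reflected order, where it is
simple, by an `osp(1|2)` computation. Nilpotency on one nonzero vector spreads to all of `V`
(`locNil_T`), commutators carry it to all lowering operators (`locNil_of_simple`), and a module
generated from one vector by locally nilpotent lowering operators is finite dimensional
(`IsIrreducible.finiteDimensional`). -/

namespace OSP

/-! ### Root matrices of `osp` and their supercommutators. -/

/-- The index of the dual basis vector. -/
def dual {m n : ℕ} : Idx m n → Idx m n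
  | Sum.inl r => Sum.inr (Sum.inr r)
  | Sum.inr (Sum.inl _) => Sum.inr (Sum.inl ())
  | Sum.inr (Sum.inr r) => Sum.inl r

@[simp] theorem dual_dual {m n : ℕ} (i : Idx m n) : dual (dual i) = i := by
  rcases i with r | u | r <;> rfl

@[simp] theorem parity_dual {m n : ℕ} (i : Idx m n) : parity (dual i) = parity i := by
  rcases i with r | u | r <;> rfl

theorem dual_inj {m n : ℕ} {i j : Idx m n} : dual i = dual j ↔ i = j :=
  ⟨fun h => by rw [← dual_dual i, h, dual_dual], fun h => h ▸ rfl⟩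

theorem dual_eq_iff {m n : ℕ} {i j : Idx m n} : dual i = j ↔ i = dual j :=
  ⟨fun h => by rw [← h, dual_dual], fun h => by rw [h, dual_dual]⟩

@[simp] theorem dual_zeroIdx {m n : ℕ} : dual (zeroIdx : Idx m n) = zeroIdx := rfl
@[simp] theorem dual_posIdx {m n : ℕ} (r : PIdx m n) : dual (posIdx r) = barIdx r := rfl
@[simp] theorem dual_barIdx {m n : ℕ} (r : PIdx m n) : dual (barIdx r) = posIdx r := rfl

theorem dual_ne_self {m n : ℕ} {i : Idx m n} (h : i ≠ zeroIdx) : dual i ≠ i := by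
  rcases i with r | u | r
  · simp [dual]
  · exact absurd rfl h
  · simp [dual]

/-- The nonzero entry of the Gram matrix in row `i`. -/
def gsign {m n : ℕ} : Idx m n → ℂ
  | Sum.inl r => sgn (pparity r)
  | _ => 1

theorem sgn_zero : sgn 0 = 1 := by simp [sgn]
theorem sgn_one : sgn 1 = -1 := by simp [sgn]

theorem gsign_mul_self {m n : ℕ} (i : Idx m n) : gsign i * gsign i = 1 := by
  rcases i with r | u | r <;> simp [gsign, sgn_mul_self]

theorem gsign_dual {m n : ℕ} (i : Idx m n) : gsign (dual i) = sgn (parity i) * gsign i := by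
  rcases i with r | u | r <;> simp [gsign, sgn_mul_self, dual, parity, sgn_zero]

theorem gram_apply {m n : ℕ} (i j : Idx m n) :
    gram m n i j = if dual i = j then gsign i else 0 := by
  have h2 : ∀ a : ZMod 2, a * a = a := by decide
  rcases i with r | u | r <;> rcases j with s | w | s <;> simp [gram, gsign, dual]
  · by_cases h : s = r
    · subst h; simp [h2]
    · simp [h, Ne.symm h]

/-- The sign relating the entries `(i, j)` and `(j', i')` of a matrix in `osp`. -/
def flipSign {m n : ℕ} (i j : Idx m n) : ℂ :=
  gsign i * gsign j * sgn ((parity i + parity j) * parity j)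

theorem flipSign_mul_self {m n : ℕ} (i j : Idx m n) : flipSign i j * flipSign i j = 1 := by
  unfold flipSign
  linear_combination gsign j * gsign j * (sgn ((parity i + parity j) * parity j) *
    sgn ((parity i + parity j) * parity j)) * gsign_mul_self i +
    (sgn ((parity i + parity j) * parity j) *
    sgn ((parity i + parity j) * parity j)) * gsign_mul_self j +
    sgn_mul_self ((parity i + parity j) * parity j)

theorem flipSign_ne_zero {m n : ℕ} (i j : Idx m n) : flipSign i j ≠ 0 := by
  intro h
  have := flipSign_mul_self i j
  simp [h] at this

theorem flipSign_dual {m n : ℕ} (i j : Idx m n) :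
    flipSign (dual j) (dual i) = flipSign i j := by
  have h : ∀ a b : ZMod 2, sgn b * sgn a * sgn ((b + a) * a) = sgn ((a + b) * b) := by
    intro a b
    rw [← sgn_add, ← sgn_add]
    congr 1
    revert a b
    decide
  unfold flipSign
  rw [gsign_dual, gsign_dual, parity_dual, parity_dual]
  linear_combination gsign i * gsign j * h (parity i) (parity j)

theorem flipSign_self {m n : ℕ} (i : Idx m n) : flipSign i i = 1 := by
  have h : ∀ a : ZMod 2, (a + a) * a = 0 := by decide
  rw [flipSign, gsign_mul_self, h, sgn_zero, one_mul]

theorem flipSign_self_dual {m n : ℕ} (i : Idx m n) : flipSign i (dual i) = sgn (parity i) := by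
  have h : ∀ a : ZMod 2, (a + a) * a = 0 := by decide
  rw [flipSign, gsign_dual, parity_dual, h, sgn_zero, mul_one]
  linear_combination sgn (parity i) * gsign_mul_self i

/-- Each row and column of the Gram matrix has a single nonzero entry, so the defining equations
merely pair the entries at `(i, j)` and `(dual j, dual i)`. -/
theorem mem_osp_iff {m n : ℕ} {A : Matrix (Idx m n) (Idx m n) ℂ} :
    A ∈ osp m n ↔ ∀ i j, A i j = - flipSign i j * A (dual j) (dual i) := by
  have e1 : ∀ i j, (A.transpose * gram m n) j (dual i) = gsign i * A i j := by
    intro i j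
    rw [Matrix.mul_apply, Finset.sum_eq_single i]
    · simp [gram_apply, mul_comm]
    · intro k _ hk
      rw [gram_apply, if_neg (fun h => hk (dual_inj.1 h)), mul_zero]
    · simp
  have e2 : ∀ i j, (gram m n * A) j (dual i) = gsign j * A (dual j) (dual i) := by
    intro i j
    rw [Matrix.mul_apply, Finset.sum_eq_single (dual j)]
    · simp [gram_apply]
    · intro k _ hk
      rw [gram_apply, if_neg (fun h => hk h.symm), zero_mul]
    · simp
  have h2 : ∀ a b : ZMod 2, (b + a) * b = (a + b) * b := by decide
  constructor
  · intro h i j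
    have := h j (dual i)
    rw [e1, e2, parity_dual, h2] at this
    unfold flipSign
    linear_combination gsign i * this - A i j * gsign_mul_self i
  · intro h j k
    have := h (dual k) j
    have e3 := e1 (dual k) j
    have e4 := e2 (dual k) j
    rw [dual_dual] at e3 e4 this
    rw [e3, e4]
    rw [flipSign, parity_dual] at this
    rw [h2]
    linear_combination gsign (dual k) * this - (gsign j *
      sgn ((parity k + parity j) * parity j) * A (dual j) k) * gsign_mul_self (dual k)

/-- The spanning vectors of `osp` as matrices. -/
def rootMatrix {m n : ℕ} (i j : Idx m n) : Matrix (Idx m n) (Idx m n) ℂ :=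
  Matrix.single i j 1 - flipSign i j • Matrix.single (dual j) (dual i) 1

theorem rootMatrix_mem {m n : ℕ} (i j : Idx m n) : rootMatrix i j ∈ osp m n := by
  rw [mem_osp_iff]
  intro a b
  simp only [rootMatrix, Matrix.sub_apply, Matrix.smul_apply, Matrix.single_apply, smul_eq_mul]
  have e1 : (i = dual b ∧ j = dual a) ↔ (dual j = a ∧ dual i = b) := by
    rw [dual_eq_iff, dual_eq_iff]; tauto
  have e2 : (dual j = dual b ∧ dual i = dual a) ↔ (i = a ∧ j = b) := by
    rw [dual_inj, dual_inj]; tauto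
  simp only [e1, e2]
  by_cases h : i = a ∧ j = b
  · obtain ⟨rfl, rfl⟩ := h
    by_cases h' : dual j = i ∧ dual i = j
    · simp only [h', and_self, if_true]
      linear_combination -flipSign_mul_self i j
    · simp only [h', and_self, if_true, if_false]
      linear_combination -flipSign_mul_self i j
  · by_cases h' : dual j = a ∧ dual i = b
    · obtain ⟨rfl, rfl⟩ := h'
      simp only [h, if_false, and_self, if_true]
      rw [flipSign_dual]
      ring
    · simp only [h, h', if_false]
      ring

theorem rootMatrix_mem_glPart {m n : ℕ} (i j : Idx m n) :
    rootMatrix i j ∈ glPart m n (parity i + parity j) := by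
  intro a b h
  simp only [rootMatrix, Matrix.sub_apply, Matrix.smul_apply, Matrix.single_apply, smul_eq_mul]
  rw [if_neg, if_neg]
  · simp
  · rintro ⟨rfl, rfl⟩
    simp [add_comm] at h
  · rintro ⟨rfl, rfl⟩
    exact h rfl

theorem rootMatrix_flip {m n : ℕ} (i j : Idx m n) :
    rootMatrix i j = -flipSign i j • rootMatrix (dual j) (dual i) := by
  simp only [rootMatrix, dual_dual, flipSign_dual]
  rw [smul_sub, smul_smul, neg_mul, flipSign_mul_self]
  simp only [neg_smul, one_smul]
  abel

/-- The sum meets both `(i, j)` and `(dual j, dual i)`, whose root matrices are proportional; this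
is the factor 2. Summing over all pairs avoids choosing a basis of `osp`. -/
theorem two_smul_eq_sum_rootMatrix {m n : ℕ} {A : Matrix (Idx m n) (Idx m n) ℂ}
    (hA : A ∈ osp m n) : (2 : ℂ) • A = ∑ i, ∑ j, A i j • rootMatrix i j := by
  rw [mem_osp_iff] at hA
  have e1 : A = ∑ i, ∑ j, A i j • Matrix.single i j (1 : ℂ) := by
    conv_lhs => rw [Matrix.matrix_eq_sum_single A]
    simp [Matrix.smul_single]
  have e2 : A = ∑ i, ∑ j, (-(A i j * flipSign i j)) • Matrix.single (dual j) (dual i) (1 : ℂ) := by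
    let D : Idx m n ≃ Idx m n := ⟨dual, dual, dual_dual, dual_dual⟩
    rw [Finset.sum_comm]
    conv_lhs => rw [e1]
    refine (Fintype.sum_equiv D _ _ fun j => Fintype.sum_equiv D _ _ fun i => ?_)
    change A j i • _ = (-(A (dual i) (dual j) * flipSign (dual i) (dual j))) •
      Matrix.single (dual (dual j)) (dual (dual i)) (1 : ℂ)
    rw [dual_dual, dual_dual, hA j i, flipSign_dual]
    congr 1
    ring
  calc (2 : ℂ) • A = A + A := two_smul _ _
    _ = _ := by
      nth_rewrite 1 [e1]
      rw [e2]
      simp only [← Finset.sum_add_distrib]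
      refine Finset.sum_congr rfl fun i _ => Finset.sum_congr rfl fun j _ => ?_
      rw [← e2, rootMatrix, smul_sub, smul_smul, neg_smul, sub_eq_add_neg]

theorem single_mul_single_ite {m n : ℕ} (i j k l : Idx m n) :
    (Matrix.single i j (1 : ℂ)) * Matrix.single k l 1
      = (if j = k then 1 else 0 : ℂ) • Matrix.single i l 1 := by
  split_ifs with h
  · subst h; simp
  · rw [Matrix.single_mul_single_of_ne _ _ _ _ h, zero_smul]

/-- The supercommutators of the spanning vectors. -/
theorem superBracket_rootMatrix {m n : ℕ} (i j k l : Idx m n) :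
    superBracket (rootMatrix i j) (rootMatrix k l) =
      (if j = k then 1 else 0 : ℂ) • rootMatrix i l
      - (sgn ((parity i + parity j) * (parity k + parity l)) * if i = l then 1 else 0 : ℂ) •
          rootMatrix k j
      - (flipSign i j * if dual i = k then 1 else 0) • rootMatrix (dual j) l
      + (flipSign i j * sgn ((parity i + parity j) * (parity k + parity l)) *
          if dual j = l then 1 else 0) • rootMatrix k (dual i) := by
  rw [superBracket_of_mem (rootMatrix_mem_glPart i j) (rootMatrix_mem_glPart k l)]
  simp only [rootMatrix, Matrix.sub_mul, Matrix.mul_sub, Matrix.smul_mul, Matrix.mul_smul,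
    single_mul_single_ite, dual_dual, dual_inj]
  set σ := sgn ((parity i + parity j) * (parity k + parity l)) with hσ
  -- `q1` to `q4` match the flipped halves of the four root matrices on the right. Once the squares
  -- of `gsign` cancel, each is an identity between exponents in `ZMod 2`.
  have q1 : (if j = k then 1 else 0 : ℂ) * (flipSign i l) =
      (if k = j then 1 else 0 : ℂ) * (σ * (flipSign i j * flipSign k l)) := by
    by_cases h : j = k
    · subst h
      simp only [if_true, one_mul, hσ, flipSign]
      have : sgn ((parity i + parity l) * parity l) =
        sgn ((parity i + parity j) * (parity j + parity l)) *
        (sgn ((parity i + parity j) * parity j) * sgn ((parity j + parity l) * parity l)) := by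
        rw [← sgn_add, ← sgn_add]; congr 1
        generalize parity i = a; generalize parity j = b; generalize parity l = c
        revert a b c; decide
      rw [this]
      linear_combination -(gsign i * gsign l * sgn ((parity i + parity j) * (parity j + parity l)) *
        (sgn ((parity i + parity j) * parity j) * sgn ((parity j + parity l) * parity l))) * gsign_mul_self j
    · simp [h, Ne.symm h]
  have q2 : σ * (if i = l then 1 else 0 : ℂ) * flipSign k j =
      (if l = i then 1 else 0 : ℂ) * (flipSign i j * flipSign k l) := by
    by_cases h : i = l
    · subst h
      simp only [if_true, one_mul, mul_one, hσ, flipSign]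
      have : sgn ((parity i + parity j) * (parity k + parity i)) * sgn ((parity k + parity j) * parity j) =
        (sgn ((parity i + parity j) * parity j) * sgn ((parity k + parity i) * parity i)) := by
        rw [← sgn_add, ← sgn_add]; congr 1
        generalize parity i = a; generalize parity j = b; generalize parity k = c
        revert a b c; decide
      linear_combination gsign k * gsign j * this - gsign k * gsign j *
        (sgn ((parity i + parity j) * parity j) * sgn ((parity k + parity i) * parity i)) * gsign_mul_self i
    · simp [h, Ne.symm h]
  have q3 : flipSign i j * (if dual i = k then 1 else 0 : ℂ) * flipSign (dual j) l =
      σ * (flipSign k l * (if dual k = i then 1 else 0 : ℂ)) := by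
    by_cases h : dual i = k
    · subst h
      simp only [if_true, mul_one, hσ, flipSign, dual_dual, parity_dual, gsign_dual]
      have : sgn (parity j) * sgn ((parity i + parity j) * parity j) *
          sgn ((parity j + parity l) * parity l) =
          sgn (parity i) * sgn ((parity i + parity j) * (parity i + parity l)) *
          sgn ((parity i + parity l) * parity l) := by
        rw [← sgn_add, ← sgn_add, ← sgn_add, ← sgn_add]; congr 1
        generalize parity i = a; generalize parity j = b; generalize parity l = c
        revert a b c; decide
      linear_combination gsign i * gsign l * this + gsign i * gsign l * (sgn (parity j) *
        sgn ((parity i + parity j) * parity j) *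
          sgn ((parity j + parity l) * parity l)) * gsign_mul_self j
    · have h' : ¬ dual k = i := fun e => h (dual_eq_iff.2 e.symm)
      simp [h, h']
  have q4 : flipSign i j * σ * (if dual j = l then 1 else 0 : ℂ) * flipSign k (dual i) =
      flipSign k l * (if j = dual l then 1 else 0 : ℂ) := by
    by_cases h : dual j = l
    · subst h
      simp only [if_true, mul_one, hσ, flipSign, dual_dual, parity_dual, gsign_dual]
      have : sgn (parity i) * sgn ((parity i + parity j) * parity j) *
          sgn ((parity i + parity j) * (parity k + parity j)) *
          sgn ((parity k + parity i) * parity i) =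
          sgn (parity j) * sgn ((parity k + parity j) * parity j) := by
        rw [← sgn_add, ← sgn_add, ← sgn_add, ← sgn_add]; congr 1
        generalize parity i = a; generalize parity j = b; generalize parity k = c
        revert a b c; decide
      linear_combination gsign k * gsign j * this + gsign k * gsign j * (sgn (parity i) *
        sgn ((parity i + parity j) * parity j) *
          sgn ((parity i + parity j) * (parity k + parity j)) *
          sgn ((parity k + parity i) * parity i)) * gsign_mul_self i
    · have h' : ¬ j = dual l := fun e => h (dual_eq_iff.2 e)
      simp [h, h']
  have e1 : (if dual k = i then 1 else 0 : ℂ) = if dual i = k then 1 else 0 := by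
    have : dual k = i ↔ dual i = k := by rw [dual_eq_iff, eq_comm]
    simp only [this]
  have e2 : (if l = dual j then 1 else 0 : ℂ) = if dual j = l then 1 else 0 := by
    simp only [eq_comm]
  have e3 : (if l = i then 1 else 0 : ℂ) = if i = l then 1 else 0 := by
    simp only [eq_comm]
  have e4 : (if k = j then 1 else 0 : ℂ) = if j = k then 1 else 0 := by
    simp only [eq_comm]
  have e5 : (if j = dual l then 1 else 0 : ℂ) = if dual j = l then 1 else 0 := by
    simp only [dual_eq_iff]
  rw [e1] at q3
  rw [e3] at q2
  rw [e4] at q1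
  rw [e5] at q4
  simp only [e1, e2, e3, e4, e5]
  simp only [smul_sub, smul_smul]
  linear_combination (norm := module) q1 • Matrix.single (dual l) (dual i) (1 : ℂ)
    - q2 • Matrix.single (dual j) (dual k) (1 : ℂ) - q3 • Matrix.single (dual l) j (1 : ℂ)
    + q4 • Matrix.single i (dual k) (1 : ℂ)

end OSP

/-! ### Commutation relations of root vectors on a module. -/

namespace OSP

variable {m n : ℕ} {V : Type*} [AddCommGroup V] [Module ℂ V]

/-- The action of the spanning vectors of `osp`. -/
def OspModule.T (M : OspModule m n V) (i j : Idx m n) : Module.End ℂ V :=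
  M.act ⟨rootMatrix i j, rootMatrix_mem i j⟩

namespace OspModule

theorem T_mem_part (M : OspModule m n V) (i j : Idx m n) {b : ZMod 2} {v : V}
    (hv : v ∈ M.part b) : M.T i j v ∈ M.part (parity i + parity j + b) :=
  M.act_mem _ _ _ _ (rootMatrix_mem_glPart i j) hv

theorem T_flip (M : OspModule m n V) (i j : Idx m n) :
    M.T i j = -flipSign i j • M.T (dual j) (dual i) := by
  unfold T
  rw [← map_smul]
  congr 1
  exact Subtype.ext (rootMatrix_flip i j)

theorem T_mul_T (M : OspModule m n V) (i j k l : Idx m n) :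
    M.T i j * M.T k l = sgn ((parity i + parity j) * (parity k + parity l)) • (M.T k l * M.T i j)
      + ((if j = k then 1 else 0 : ℂ) • M.T i l
      - (sgn ((parity i + parity j) * (parity k + parity l)) * if i = l then 1 else 0 : ℂ) •
          M.T k j
      - (flipSign i j * if dual i = k then 1 else 0) • M.T (dual j) l
      + (flipSign i j * sgn ((parity i + parity j) * (parity k + parity l)) *
          if dual j = l then 1 else 0) • M.T k (dual i)) := by
  have h := M.act_bracket _ _ ⟨rootMatrix i j, rootMatrix_mem i j⟩ ⟨rootMatrix k l, rootMatrix_mem k l⟩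
    (rootMatrix_mem_glPart i j) (rootMatrix_mem_glPart k l)
  rw [eq_sub_iff_add_eq'] at h
  unfold T
  rw [← h, ← map_smul, ← map_smul, ← map_smul, ← map_smul, ← map_sub, ← map_sub, ← map_add]
  congr 2
  exact Subtype.ext (superBracket_rootMatrix i j k l)

theorem T_T (M : OspModule m n V) (i j k l : Idx m n) (v : V) :
    M.T i j (M.T k l v) =
      sgn ((parity i + parity j) * (parity k + parity l)) • M.T k l (M.T i j v)
      + ((if j = k then 1 else 0 : ℂ) • M.T i l v
      - (sgn ((parity i + parity j) * (parity k + parity l)) * if i = l then 1 else 0 : ℂ) •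
          M.T k j v
      - (flipSign i j * if dual i = k then 1 else 0) • M.T (dual j) l v
      + (flipSign i j * sgn ((parity i + parity j) * (parity k + parity l)) *
          if dual j = l then 1 else 0) • M.T k (dual i) v) := by
  have := congrArg (fun f : Module.End ℂ V => f v) (M.T_mul_T i j k l)
  exact this

/-- Membership of `T i j (T k l v)` in a subspace from that of the terms of the commutation
relation. -/
theorem T_T_mem (M : OspModule m n V) {i j k l : Idx m n} {v : V} {W : Submodule ℂ V}
    (h0 : M.T k l (M.T i j v) ∈ W) (h1 : j = k → M.T i l v ∈ W) (h2 : i = l → M.T k j v ∈ W)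
    (h3 : dual i = k → M.T (dual j) l v ∈ W) (h4 : dual j = l → M.T k (dual i) v ∈ W) :
    M.T i j (M.T k l v) ∈ W := by
  rw [T_T]
  refine W.add_mem (W.smul_mem _ h0) (W.add_mem (W.sub_mem (W.sub_mem ?_ ?_) ?_) ?_)
  · split_ifs with h
    · exact W.smul_mem _ (h1 h)
    · simp
  · split_ifs with h
    · exact W.smul_mem _ (h2 h)
    · simp
  · split_ifs with h
    · exact W.smul_mem _ (h3 h)
    · simp
  · split_ifs with h
    · exact W.smul_mem _ (h4 h)
    · simp

theorem act_mem_of_T_mem (M : OspModule m n V) {W : Submodule ℂ V} {v : V}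
    (h : ∀ i j, M.T i j v ∈ W) (x : osp m n) : M.act x v ∈ W := by
  have e : (2 : ℂ) • x = ∑ i, ∑ j, x.1 i j • (⟨rootMatrix i j, rootMatrix_mem i j⟩ : osp m n) := by
    apply Subtype.ext
    have := two_smul_eq_sum_rootMatrix x.2
    simpa using this
  have e2 : M.act x v = (2⁻¹ : ℂ) • ∑ i, ∑ j, x.1 i j • M.T i j v := by
    have := congrArg (fun y => (2⁻¹ : ℂ) • M.act y v) e
    simp only [map_smul, map_sum, LinearMap.smul_apply, LinearMap.sum_apply] at this
    rw [smul_smul, inv_mul_cancel₀ two_ne_zero, one_smul] at this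
    exact this
  rw [e2]
  exact W.smul_mem _ (W.sum_mem fun i _ => W.sum_mem fun j _ => W.smul_mem _ (h i j))

theorem IsIrreducible.eq_top {M : OspModule m n V} (hM : M.IsIrreducible) {W : Submodule ℂ V}
    (hg : W = (W ⊓ M.part 0) ⊔ (W ⊓ M.part 1)) (hs : ∀ i j, ∀ v ∈ W, M.T i j v ∈ W)
    {u : V} (hu : u ∈ W) (h0 : u ≠ 0) : W = ⊤ := by
  rcases hM.2 W hg (fun x w hw => M.act_mem_of_T_mem (fun i j => hs i j w hw) x) with h | h
  · rw [h] at hu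
    exact absurd hu (by simpa using h0)
  · exact h

/-- The weight of `rootMatrix i j`. -/
def rootWt (i j k : Idx m n) : ℤ :=
  (if k = i then 1 else 0) - (if k = j then 1 else 0) - (if dual k = i then 1 else 0)
    + (if dual k = j then 1 else 0)

theorem T_diag_T (M : OspModule m n V) (k i j : Idx m n) (v : V) :
    M.T k k (M.T i j v) = M.T i j (M.T k k v) + (rootWt i j k : ℂ) • M.T i j v := by
  have h : ∀ a b : ZMod 2, (a + a) * b = 0 := by decide
  rw [T_T, h, sgn_zero, one_smul, flipSign_self]
  congr 1
  have e1 : (if k = i then 1 else 0 : ℂ) • M.T k j v = (if k = i then 1 else 0 : ℂ) • M.T i j v := by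
    split_ifs with h
    · rw [h]
    · simp
  have e2 : (1 * if k = j then 1 else 0 : ℂ) • M.T i k v
      = (if k = j then 1 else 0 : ℂ) • M.T i j v := by
    split_ifs with h
    · rw [h, one_mul]
    · simp
  have e3 : (1 * if dual k = i then 1 else 0 : ℂ) • M.T (dual k) j v
      = (if dual k = i then 1 else 0 : ℂ) • M.T i j v := by
    split_ifs with h
    · rw [h, one_mul]
    · simp
  have e4 : (1 * 1 * if dual k = j then 1 else 0 : ℂ) • M.T i (dual k) v
      = (if dual k = j then 1 else 0 : ℂ) • M.T i j v := by
    split_ifs with h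
    · rw [h, one_mul, one_mul]
    · simp
  rw [e1, e2, e3, e4, rootWt, ← sub_smul, ← sub_smul, ← add_smul]
  push_cast
  rfl

/-! ### Weight vectors, singular vectors and generation by lowering operators. -/

/-- `v` is a weight vector on which `rootMatrix k k` acts by `w k`. -/
def IsWt (M : OspModule m n V) (w : Idx m n → ℂ) (v : V) : Prop := ∀ k, M.T k k v = w k • v

theorem IsWt.T {M : OspModule m n V} {w : Idx m n → ℂ} {v : V} (h : M.IsWt w v) (i j : Idx m n) :
    M.IsWt (fun k => w k + rootWt i j k) (M.T i j v) := by
  intro k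
  rw [T_diag_T, h k, map_smul, add_smul]

theorem IsWt.pow {M : OspModule m n V} {w : Idx m n → ℂ} {v : V} (h : M.IsWt w v) (i j : Idx m n)
    (N : ℕ) : M.IsWt (fun k => w k + N * rootWt i j k) ((M.T i j ^ N) v) := by
  induction N with
  | zero => simpa using h
  | succ N ih =>
    rw [pow_succ', Module.End.mul_apply]
    convert ih.T i j using 2
    push_cast
    ring

theorem pow_mem_part (M : OspModule m n V) (i j : Idx m n) {b : ZMod 2} {v : V}
    (hv : v ∈ M.part b) (N : ℕ) : ∃ c, (M.T i j ^ N) v ∈ M.part c := by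
  induction N with
  | zero => exact ⟨b, by simpa using hv⟩
  | succ N ih =>
    obtain ⟨c, hc⟩ := ih
    rw [pow_succ', Module.End.mul_apply]
    exact ⟨_, M.T_mem_part i j hc⟩

/-- An order on the basis of the natural module that defines a Borel subalgebra. -/
structure _root_.OSP.IsOrder (p : Idx m n → ℤ) : Prop where
  inj : Function.Injective p
  anti : ∀ i, p (dual i) = - p i

/-- Singular vectors for the Borel subalgebra defined by `p`. -/
def IsSing (M : OspModule m n V) (p : Idx m n → ℤ) (v : V) : Prop :=
  ∀ i j, p i < p j → M.T i j v = 0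

/-- The eigenvalue of the grading operator on vectors of weight `w`. -/
def grade (p : Idx m n → ℤ) (w : Idx m n → ℂ) : ℂ := ∑ k, (p k : ℂ) * w k

/-- The grading operator. -/
def gradeOp (M : OspModule m n V) (p : Idx m n → ℤ) : Module.End ℂ V :=
  ∑ k, (p k : ℂ) • M.T k k

theorem IsWt.gradeOp {M : OspModule m n V} {w : Idx m n → ℂ} {v : V} (h : M.IsWt w v)
    (p : Idx m n → ℤ) : M.gradeOp p v = grade p w • v := by
  simp only [OspModule.gradeOp, grade, LinearMap.sum_apply, LinearMap.smul_apply, h _,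
    Finset.sum_smul, smul_smul]

/-- The factor 2 appears because an index and its dual contribute equally to `grade`. -/
theorem grade_rootWt {p : Idx m n → ℤ} (hp : IsOrder p) (i j : Idx m n) :
    grade p (fun k => (rootWt i j k : ℂ)) = 2 * ((p i - p j : ℤ) : ℂ) := by
  have e : ∀ k i : Idx m n, dual k = i ↔ k = dual i := fun k i => dual_eq_iff
  simp only [grade, rootWt, e]
  push_cast
  simp only [mul_add, mul_sub, Finset.sum_add_distrib, Finset.sum_sub_distrib]
  simp [hp.anti]
  ring

theorem grade_add_rootWt {p : Idx m n → ℤ} (hp : IsOrder p) (w : Idx m n → ℂ) (N : ℂ)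
    (i j : Idx m n) :
    grade p (fun k => w k + N * rootWt i j k) = grade p w + 2 * N * ((p i - p j : ℤ) : ℂ) := by
  have := grade_rootWt hp i j
  simp only [grade] at this ⊢
  simp only [mul_add, Finset.sum_add_distrib]
  rw [show ∑ k, (p k : ℂ) * (N * (rootWt i j k : ℂ)) = N * ∑ k, (p k : ℂ) * (rootWt i j k : ℂ) by
    rw [Finset.mul_sum]; exact Finset.sum_congr rfl fun k _ => by ring]
  rw [this]
  ring

/-- The vectors obtained from `u` by lowering operators. -/
inductive Reach (M : OspModule m n V) (p : Idx m n → ℤ) (u : V) : V → Prop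
  | base : Reach M p u u
  | step {x : V} (i j : Idx m n) : p j < p i → Reach M p u x → Reach M p u (M.T i j x)

/-- The subspace generated from `u` by lowering operators. -/
def lowSpan (M : OspModule m n V) (p : Idx m n → ℤ) (u : V) : Submodule ℂ V :=
  Submodule.span ℂ {x | M.Reach p u x}

theorem self_mem_lowSpan (M : OspModule m n V) (p : Idx m n → ℤ) (u : V) : u ∈ M.lowSpan p u :=
  Submodule.subset_span Reach.base

theorem Reach.mem_part {M : OspModule m n V} {p : Idx m n → ℤ} {u x : V} {a : ZMod 2}
    (hu : u ∈ M.part a) (h : M.Reach p u x) : ∃ b, x ∈ M.part b := by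
  induction h with
  | base => exact ⟨a, hu⟩
  | step i j _ _ ih =>
    obtain ⟨b, hb⟩ := ih
    exact ⟨_, M.T_mem_part i j hb⟩

/-- A lowering operator has `p j < p i`, so it raises the grade by the positive even integer `2 (p i
- p j)`. The grade thus measures depth below `u`. -/
theorem Reach.isWt {M : OspModule m n V} {p : Idx m n → ℤ} (hp : IsOrder p) {u x : V}
    {w : Idx m n → ℂ} (hu : M.IsWt w u) (h : M.Reach p u x) :
    ∃ w', M.IsWt w' x ∧ ∃ k : ℕ, grade p w' = grade p w + 2 * k := by
  induction h with
  | base => exact ⟨w, hu, 0, by simp⟩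
  | step i j hij _ ih =>
    obtain ⟨w', h1, k, h2⟩ := ih
    refine ⟨_, h1.T i j, k + (p i - p j).toNat, ?_⟩
    have := grade_add_rootWt hp w' 1 i j
    simp only [one_mul, mul_one] at this
    rw [this, h2]
    have h3 : ((p i - p j).toNat : ℤ) = p i - p j := Int.toNat_of_nonneg (by omega)
    have h4 : ((p i - p j).toNat : ℂ) = ((p i - p j : ℤ) : ℂ) := by exact_mod_cast congrArg (Int.cast : ℤ → ℂ) h3
    rw [← h4]
    push_cast
    ring

theorem lowSpan_le (M : OspModule m n V) {p : Idx m n → ℤ} {u : V} {W : Submodule ℂ V}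
    (hu : u ∈ W) (hW : ∀ i j, p j < p i → ∀ x ∈ W, M.T i j x ∈ W) : M.lowSpan p u ≤ W := by
  refine Submodule.span_le.2 fun x hx => ?_
  induction hx with
  | base => exact hu
  | step i j hij _ ih => exact hW i j hij _ ih

theorem T_mem_lowSpan_of_lt (M : OspModule m n V) {p : Idx m n → ℤ} {u : V} {i j : Idx m n}
    (hij : p j < p i) {x : V} (hx : x ∈ M.lowSpan p u) : M.T i j x ∈ M.lowSpan p u := by
  induction hx using Submodule.span_induction with
  | mem x hx => exact Submodule.subset_span (Reach.step i j hij hx)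
  | zero => simp
  | add x y _ _ hx hy => rw [map_add]; exact Submodule.add_mem _ hx hy
  | smul c x _ hx => rw [map_smul]; exact Submodule.smul_mem _ _ hx

/-- Induction on the lowering word: commuting a root vector past the outermost letter leaves root
vectors applied to a shorter word. The commutator can be any root vector, so the induction must
treat all of them at once. -/
theorem T_mem_lowSpan (M : OspModule m n V) {p : Idx m n → ℤ} (hp : IsOrder p) {u : V}
    {w : Idx m n → ℂ} (hw : M.IsWt w u) (hs : M.IsSing p u) (i j : Idx m n) {x : V}
    (hx : x ∈ M.lowSpan p u) : M.T i j x ∈ M.lowSpan p u := by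
  have key : ∀ x, M.Reach p u x → ∀ i j, M.T i j x ∈ M.lowSpan p u := by
    intro x hx
    induction hx with
    | base =>
      intro i j
      rcases lt_trichotomy (p i) (p j) with h | h | h
      · rw [hs i j h]; exact Submodule.zero_mem _
      · rw [← hp.inj h, hw i]
        exact Submodule.smul_mem _ _ (M.self_mem_lowSpan p u)
      · exact M.T_mem_lowSpan_of_lt h (M.self_mem_lowSpan p u)
    | step k l hkl _ ih =>
      intro i j
      exact M.T_T_mem (M.T_mem_lowSpan_of_lt hkl (ih i j)) (fun _ => ih _ _) (fun _ => ih _ _)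
        (fun _ => ih _ _) (fun _ => ih _ _)
  induction hx using Submodule.span_induction with
  | mem x hx => exact key x hx i j
  | zero => simp
  | add x y _ _ hx hy => rw [map_add]; exact Submodule.add_mem _ hx hy
  | smul c x _ hx => rw [map_smul]; exact Submodule.smul_mem _ _ hx

theorem span_graded (M : OspModule m n V) {S : Set V} (h : ∀ x ∈ S, ∃ b, x ∈ M.part b) :
    Submodule.span ℂ S = (Submodule.span ℂ S ⊓ M.part 0) ⊔ (Submodule.span ℂ S ⊓ M.part 1) := by
  apply le_antisymm
  · refine Submodule.span_le.2 fun x hx => ?_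
    obtain ⟨b, hb⟩ := h x hx
    have h2 : ∀ c : ZMod 2, c = 0 ∨ c = 1 := by decide
    rcases h2 b with rfl | rfl
    · exact Submodule.mem_sup_left ⟨Submodule.subset_span hx, hb⟩
    · exact Submodule.mem_sup_right ⟨Submodule.subset_span hx, hb⟩
  · exact sup_le inf_le_left inf_le_left

/-- A non-zero homogeneous singular weight vector generates an irreducible module by lowering
operators. -/
theorem IsIrreducible.lowSpan_eq_top {M : OspModule m n V} (hM : M.IsIrreducible)
    {p : Idx m n → ℤ} (hp : IsOrder p) {u : V} {w : Idx m n → ℂ} {a : ZMod 2} (ha : u ∈ M.part a)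
    (hw : M.IsWt w u) (hs : M.IsSing p u) (h0 : u ≠ 0) : M.lowSpan p u = ⊤ :=
  hM.eq_top (M.span_graded fun _ hx => hx.mem_part ha)
    (fun i j _ hv => M.T_mem_lowSpan hp hw hs i j hv) (M.self_mem_lowSpan p u) h0

/-- Singular vectors below another weight vanish. -/
theorem IsIrreducible.eq_zero_of_isSing {M : OspModule m n V} (hM : M.IsIrreducible)
    {p : Idx m n → ℤ} (hp : IsOrder p) {u y : V} {w w' : Idx m n → ℂ} {a : ZMod 2}
    (hu : M.IsWt w u) (h0 : u ≠ 0) (ha : y ∈ M.part a) (hy : M.IsWt w' y) (hs : M.IsSing p y)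
    (hlt : ∀ k : ℕ, grade p w ≠ grade p w' + 2 * k) : y = 0 := by
  by_contra hy0
  have htop := hM.lowSpan_eq_top hp ha hy hs hy0
  -- All of `V` lies at or below `y`, hence in eigenspaces of `gradeOp` that omit the eigenvalue of
  -- `u`. Independence of eigenspaces then forces `u = 0`.
  have hle : M.lowSpan p y ≤ ⨆ (e : ℂ) (_ : e ≠ grade p w), (M.gradeOp p).eigenspace e := by
    refine Submodule.span_le.2 fun x hx => ?_
    obtain ⟨w'', h1, k, h2⟩ := hx.isWt hp hy
    refine Submodule.mem_iSup_of_mem (grade p w'') (Submodule.mem_iSup_of_mem ?_ ?_)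
    · rw [h2]
      exact (hlt k).symm
    · exact Module.End.mem_eigenspace_iff.2 (h1.gradeOp p)
  have hd := (Module.End.eigenspaces_iSupIndep (M.gradeOp p)) (grade p w)
  rw [htop, top_le_iff] at hle
  rw [hle] at hd
  have : u ∈ (M.gradeOp p).eigenspace (grade p w) :=
    Module.End.mem_eigenspace_iff.2 (hu.gradeOp p)
  rw [disjoint_top.1 hd] at this
  exact h0 (by simpa using this)

/-- The grade of the power exceeds that of `u` by `2 N (p i - p j) > 0`, so lowering it further can
never lead back to `u`. -/
theorem IsIrreducible.pow_eq_zero {M : OspModule m n V} (hM : M.IsIrreducible)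
    {p : Idx m n → ℤ} (hp : IsOrder p) {u : V} {w : Idx m n → ℂ} {a : ZMod 2}
    (ha : u ∈ M.part a) (hu : M.IsWt w u) {i j : Idx m n} (hij : p j < p i) {N : ℕ} (hN : N ≠ 0)
    (hs : M.IsSing p ((M.T i j ^ N) u)) : (M.T i j ^ N) u = 0 := by
  by_cases h0 : u = 0
  · simp [h0]
  obtain ⟨b, hb⟩ := M.pow_mem_part i j ha N
  refine hM.eq_zero_of_isSing hp hu h0 hb (hu.pow i j N) hs fun k h => ?_
  rw [grade_add_rootWt hp] at h
  have h1 : (2 : ℂ) * N * ((p i - p j : ℤ) : ℂ) + 2 * k = 0 := by linear_combination -h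
  have h2 : (2 : ℤ) * N * (p i - p j) + 2 * k = 0 := by exact_mod_cast h1
  have h3 : (0 : ℤ) < N * (p i - p j) :=
    mul_pos (by exact_mod_cast Nat.pos_of_ne_zero hN) (by omega)
  nlinarith

end OspModule
end OSP

/-! ### Linear algebra: `sl_2`-strings and locally nilpotent operators. -/

namespace OSP

section LinearAlgebra

variable {V : Type*} [AddCommGroup V] [Module ℂ V]

theorem weight_pow {f h : Module.End ℂ V} {κ c : ℂ} {u : V}
    (hhf : ∀ v, h (f v) = f (h v) - κ • f v) (hu : h u = c • u) (k : ℕ) :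
    h ((f ^ k) u) = (c - κ * k) • (f ^ k) u := by
  induction k with
  | zero => simpa using hu
  | succ k ih =>
    rw [pow_succ', Module.End.mul_apply, hhf, ih, map_smul, ← sub_smul]
    congr 1
    push_cast
    ring

/-- The usual `sl_2` formula is the case `κ = 2`. A free `κ` allows `h` to stay unnormalised for
short roots and for doubled odd roots. -/
theorem raise_pow {e f h : Module.End ℂ V} {κ c : ℂ} {u : V}
    (hef : ∀ v, e (f v) = f (e v) + h v) (hhf : ∀ v, h (f v) = f (h v) - κ • f v)
    (hu : h u = c • u) (heu : e u = 0) (k : ℕ) :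
    e ((f ^ (k + 1)) u) = ((k + 1) * (c - κ * k / 2)) • (f ^ k) u := by
  induction k with
  | zero => simp [hef, heu, hu]
  | succ k ih =>
    rw [pow_succ', Module.End.mul_apply, hef, ih, weight_pow hhf hu, map_smul,
      ← Module.End.mul_apply, ← pow_succ', ← add_smul]
    congr 1
    push_cast
    ring

theorem exists_nat_of_pow_eq_zero {e f h : Module.End ℂ V} {κ c : ℂ} {u : V}
    (hef : ∀ v, e (f v) = f (e v) + h v) (hhf : ∀ v, h (f v) = f (h v) - κ • f v)
    (hu : h u = c • u) (heu : e u = 0) (hu0 : u ≠ 0) (hf : ∃ N, (f ^ N) u = 0) :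
    ∃ N : ℕ, c = κ * N / 2 := by
  classical
  have hspec := Nat.find_spec hf
  have hmin : ∀ {k}, k < Nat.find hf → ¬ (f ^ k) u = 0 := fun h => Nat.find_min hf h
  rcases hN : Nat.find hf with _ | N
  · rw [hN] at hspec
    exact absurd (by simpa using hspec) hu0
  · rw [hN] at hspec hmin
    refine ⟨N, ?_⟩
    have h1 := raise_pow hef hhf hu heu N
    rw [hspec, map_zero] at h1
    rcases smul_eq_zero.1 h1.symm with h2 | h2
    · have : (N + 1 : ℂ) ≠ 0 := by exact_mod_cast Nat.succ_ne_zero N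
      rcases mul_eq_zero.1 h2 with h3 | h3
      · exact absurd h3 this
      · linear_combination h3
    · exact absurd h2 (hmin (Nat.lt_succ_self N))

/-- If no power of `f` killed `u`, the vectors `f ^ k u` would be eigenvectors of `h` with the
pairwise distinct eigenvalues `c - κ k`. -/
theorem exists_nat_of_finiteDimensional [FiniteDimensional ℂ V] {e f h : Module.End ℂ V} {κ c : ℂ}
    {u : V} (hκ : κ ≠ 0)
    (hef : ∀ v, e (f v) = f (e v) + h v) (hhf : ∀ v, h (f v) = f (h v) - κ • f v)
    (hu : h u = c • u) (heu : e u = 0) (hu0 : u ≠ 0) : ∃ N : ℕ, c = κ * N / 2 := by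
  refine exists_nat_of_pow_eq_zero hef hhf hu heu hu0 ?_
  by_contra! hne
  have hli := Module.End.eigenvectors_linearIndependent' h (fun k : ℕ => c - κ * k)
    (fun a b hab => by
      have : κ * a = κ * b := by linear_combination -hab
      exact_mod_cast mul_left_cancel₀ hκ this) (fun k => (f ^ k) u)
    (fun k => ⟨Module.End.mem_eigenspace_iff.2 (weight_pow hhf hu k), hne k⟩)
  have := hli.finite
  exact not_finite ℕ

/-- Locally nilpotent operators. -/
def LocNil (f : Module.End ℂ V) : Prop := ∀ v, ∃ N : ℕ, (f ^ N) v = 0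

theorem pow_apply_eq_zero_of_le {f : Module.End ℂ V} {v : V} {a b : ℕ} (hab : a ≤ b)
    (h : (f ^ a) v = 0) : (f ^ b) v = 0 := by
  obtain ⟨c, rfl⟩ := Nat.exists_eq_add_of_le' hab
  rw [pow_add, Module.End.mul_apply, h, map_zero]

theorem LocNil.smul {f : Module.End ℂ V} (hf : LocNil f) (c : ℂ) : LocNil (c • f) := by
  intro v
  obtain ⟨N, hN⟩ := hf v
  exact ⟨N, by rw [smul_pow, LinearMap.smul_apply, hN, smul_zero]⟩

theorem LocNil.sq {f : Module.End ℂ V} (hf : LocNil f) : LocNil (f * f) := by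
  intro v
  obtain ⟨N, hN⟩ := hf v
  refine ⟨N, ?_⟩
  rw [← pow_two, ← pow_mul]
  exact pow_apply_eq_zero_of_le (by omega) hN

theorem locNil_of_sq_eq_zero {f : Module.End ℂ V} (hf : f * f = 0) : LocNil f := fun v =>
  ⟨2, by rw [pow_two, hf]; rfl⟩

section commutator

variable {R : Type*} [Ring R]

/-- The commutator with a fixed element. -/
def comm (y a : R) : R := y * a - a * y

/-- The Leibniz rule for the derivation `comm y`; only two terms survive because its square kills
`x`. -/
theorem comm_iterate_mul {x y z : R} (h1 : comm y x = z) (h2 : comm y z = 0) (b : R) (k : ℕ) :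
    (comm y)^[k + 1] (x * b) = x * (comm y)^[k + 1] b + (k + 1 : ℕ) • (z * (comm y)^[k] b) := by
  have hmul : ∀ a b, comm y (a * b) = comm y a * b + a * comm y b := by
    intro a b
    simp only [comm]
    noncomm_ring
  have hadd : ∀ a b, comm y (a + b) = comm y a + comm y b := by
    intro a b
    simp only [comm]
    noncomm_ring
  have hsmul : ∀ (k : ℕ) a, comm y (k • a) = k • comm y a := by
    intro k a
    simp only [comm, mul_smul_comm, smul_mul_assoc, smul_sub]
  induction k with
  | zero => simp [hmul, h1, add_comm]
  | succ k ih =>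
    rw [Function.iterate_succ_apply', ih, hadd, hmul, hsmul, hmul, h1, h2, zero_mul, zero_add,
      ← Function.iterate_succ_apply' (comm y), ← Function.iterate_succ_apply' (comm y),
      succ_nsmul _ (k + 1)]
    abel

theorem comm_iterate_pow {x y z : R} (h1 : comm y x = z) (h2 : comm y z = 0) (N : ℕ) :
    (comm y)^[N] (x ^ N) = N.factorial • z ^ N ∧ (comm y)^[N + 1] (x ^ N) = 0 := by
  induction N with
  | zero => simp [comm]
  | succ N ih =>
    constructor
    · rw [pow_succ', comm_iterate_mul h1 h2, ih.1, ih.2, mul_zero, zero_add, mul_smul_comm,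
        smul_smul, ← pow_succ', Nat.factorial_succ]
    · rw [pow_succ', comm_iterate_mul h1 h2, ih.2, mul_zero, smul_zero, add_zero,
        Function.iterate_succ_apply', ih.2]
      simp [comm]

end commutator

/-- The iterate `(comm y)^[K] (x ^ K)` equals `K! z ^ K`. It is also a combination of products `y ^
b * x ^ K * y ^ a`, which kill `w` for large `K`, since only finitely many vectors `y ^ a w` are
nonzero. -/
theorem LocNil.comm {x y z : Module.End ℂ V} (hx : LocNil x) (hy : LocNil y)
    (h1 : OSP.comm y x = z) (h2 : OSP.comm y z = 0) : LocNil z := by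
  intro w
  obtain ⟨A, hA⟩ := hy w
  choose N hN using fun a : ℕ => hx ((y ^ a) w)
  set K := (Finset.range A).sup N with hK
  have hx0 : ∀ a, (x ^ K) ((y ^ a) w) = 0 := by
    intro a
    by_cases ha : a < A
    · exact pow_apply_eq_zero_of_le (Finset.le_sup (f := N) (Finset.mem_range.2 ha)) (hN a)
    · rw [pow_apply_eq_zero_of_le (by omega) hA, map_zero]
  have hD : ∀ k a, ((OSP.comm y)^[k] (x ^ K)) ((y ^ a) w) = 0 := by
    intro k
    induction k with
    | zero => exact hx0
    | succ k ih =>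
      intro a
      rw [Function.iterate_succ_apply', OSP.comm, LinearMap.sub_apply, Module.End.mul_apply,
        Module.End.mul_apply, ih, map_zero, zero_sub, neg_eq_zero, ← Module.End.mul_apply y,
        ← pow_succ', ih]
  refine ⟨K, ?_⟩
  have := hD K 0
  rw [(comm_iterate_pow h1 h2 K).1, pow_zero, Module.End.one_apply, LinearMap.smul_apply] at this
  rw [← Nat.cast_smul_eq_nsmul ℂ] at this
  exact (smul_eq_zero.1 this).resolve_left (by exact_mod_cast Nat.factorial_ne_zero K)

/-- A family of locally nilpotent operators that supercommute up to operators of higher degree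
has finite-dimensional orbits. -/
theorem exists_finiteDimensional_stable {ι : Type*} [DecidableEq ι] (S : Finset ι)
    (x : ι → Module.End ℂ V) (deg : ι → ℤ) (hx : ∀ i ∈ S, LocNil (x i))
    (hc : ∀ i ∈ S, ∀ j ∈ S, ∃ ε : ℂ, x i * x j - ε • (x j * x i) ∈
      Submodule.span ℂ (x '' {l | l ∈ S ∧ deg i < deg l ∧ deg j < deg l})) (v : V) :
    ∃ W : Submodule ℂ V, FiniteDimensional ℂ W ∧ v ∈ W ∧ ∀ i ∈ S, ∀ w ∈ W, x i w ∈ W := by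
  induction S using Finset.induction_on_min_value deg with
  | empty =>
    exact ⟨Submodule.span ℂ {v}, inferInstance, Submodule.mem_span_singleton_self v, by simp⟩
  | insert a S ha hmin ih =>
    -- The new index `a` has the least degree, so error terms, being of strictly larger degree,
    -- never involve it.
    obtain ⟨W', hfd, hv, hW'⟩ := ih (fun i hi => hx i (Finset.mem_insert_of_mem hi)) (by
      intro i hi j hj
      obtain ⟨ε, h⟩ := hc i (Finset.mem_insert_of_mem hi) j (Finset.mem_insert_of_mem hj)
      refine ⟨ε, Submodule.span_mono (Set.image_mono ?_) h⟩
      rintro l ⟨h1, h2, h3⟩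
      refine ⟨(Finset.mem_insert.1 h1).resolve_left ?_, h2, h3⟩
      rintro rfl
      exact absurd (hmin i hi) (by omega))
    have hK : ∃ K : ℕ, ∀ w ∈ W', (x a ^ K) w = 0 := by
      obtain ⟨s, hs⟩ := (Submodule.fg_iff_finiteDimensional W').2 hfd
      choose N hN using hx a (Finset.mem_insert_self a S)
      refine ⟨s.sup N, fun w hw => ?_⟩
      rw [← hs] at hw
      have : Submodule.span ℂ (s : Set V) ≤ LinearMap.ker (x a ^ s.sup N) :=
        Submodule.span_le.2 fun w hw =>
          pow_apply_eq_zero_of_le (Finset.le_sup (f := N) hw) (hN w)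
      exact this hw
    obtain ⟨K, hK⟩ := hK
    -- As in a Poincaré–Birkhoff–Witt argument, the powers of `x a` stand to the left of everything
    -- else. Finite generation of `W'` makes one bound `K` work for all of it.
    set W : Submodule ℂ V := ⨆ k : Fin K, W'.map (x a ^ (k : ℕ)) with hWdef
    have hmem : ∀ k : ℕ, ∀ w ∈ W', (x a ^ k) w ∈ W := by
      intro k w hw
      by_cases hk : k < K
      · exact Submodule.mem_iSup_of_mem (⟨k, hk⟩ : Fin K) (Submodule.mem_map_of_mem hw)
      · rw [pow_apply_eq_zero_of_le (by omega) (hK w hw)]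
        exact W.zero_mem
    have hext : ∀ f : Module.End ℂ V, (∀ k : ℕ, ∀ w ∈ W', f ((x a ^ k) w) ∈ W) →
        ∀ w ∈ W, f w ∈ W := by
      intro f hf
      have : W ≤ W.comap f := by
        refine iSup_le fun k => ?_
        rintro _ ⟨w, hw, rfl⟩
        exact hf k w hw
      exact this
    have hastab : ∀ w ∈ W, x a w ∈ W := hext _ fun k w hw => by
      rw [← Module.End.mul_apply, ← pow_succ']
      exact hmem _ w hw
    have hstab : ∀ k : ℕ, ∀ i ∈ S, ∀ w ∈ W', x i ((x a ^ k) w) ∈ W := by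
      intro k
      induction k with
      | zero => exact fun i hi w hw => hmem 0 _ (hW' i hi w hw)
      | succ k ihk =>
        intro i hi w hw
        obtain ⟨ε, h⟩ := hc i (Finset.mem_insert_of_mem hi) a (Finset.mem_insert_self a S)
        have h1 : (x i * x a - ε • (x a * x i)) ((x a ^ k) w) ∈ W := by
          have : Submodule.span ℂ (x '' {l | l ∈ insert a S ∧ deg i < deg l ∧ deg a < deg l}) ≤
              W.comap (LinearMap.applyₗ ((x a ^ k) w)) := by
            refine Submodule.span_le.2 ?_
            rintro _ ⟨l, ⟨h1, -, h2⟩, rfl⟩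
            refine ihk l ((Finset.mem_insert.1 h1).resolve_left ?_) w hw
            rintro rfl
            exact lt_irrefl _ h2
          exact this h
        have h2 : x i ((x a ^ (k + 1)) w) = (x i * x a - ε • (x a * x i)) ((x a ^ k) w)
            + ε • x a (x i ((x a ^ k) w)) := by
          rw [pow_succ']
          simp
        rw [h2]
        exact W.add_mem h1 (W.smul_mem _ (hastab _ (ihk i hi w hw)))
    refine ⟨W, inferInstance, by simpa using hmem 0 v hv, fun i hi => ?_⟩
    rcases Finset.mem_insert.1 hi with rfl | hi
    · exact hastab
    · exact hext _ fun k w hw => hstab k i hi w hw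

end LinearAlgebra

/-! ### Spreading nilpotency over an irreducible module; the finiteness criterion. -/

namespace OspModule

variable {m n : ℕ} {V : Type*} [AddCommGroup V] [Module ℂ V]

/-- The vectors on which `T i j` acts nilpotently. -/
def nilSpace (M : OspModule m n V) (i j : Idx m n) : Submodule ℂ V :=
  (M.T i j).maxGenEigenspace 0

theorem mem_nilSpace {M : OspModule m n V} {i j : Idx m n} {v : V} :
    v ∈ M.nilSpace i j ↔ ∃ N : ℕ, (M.T i j ^ N) v = 0 := by
  rw [nilSpace, Module.End.mem_maxGenEigenspace, zero_smul, sub_zero]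

theorem mem_nilSpace_of_T {M : OspModule m n V} {i j : Idx m n} {v : V}
    (h : M.T i j v ∈ M.nilSpace i j) : v ∈ M.nilSpace i j := by
  rw [mem_nilSpace] at h ⊢
  obtain ⟨N, hN⟩ := h
  exact ⟨N + 1, by rw [pow_succ]; exact hN⟩

/-- Double induction: commuting with `T i j` lowers `p l - p k` by `p i - p j > 0`, and the inner
induction is on the exponent that kills `v`. -/
theorem T_mem_nilSpace (M : OspModule m n V) {p : Idx m n → ℤ} (hp : IsOrder p) {i j : Idx m n}
    (hij : p j < p i) (k l : Idx m n) {v : V} (hv : v ∈ M.nilSpace i j) :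
    M.T k l v ∈ M.nilSpace i j := by
  obtain ⟨B, hB⟩ : ∃ B : ℤ, ∀ k, -B ≤ p k ∧ p k ≤ B := by
    refine ⟨∑ k, |p k|, fun k => ?_⟩
    have := Finset.single_le_sum (f := fun k => |p k|) (fun k _ => abs_nonneg _) (Finset.mem_univ k)
    exact abs_le.1 this
  -- The shift by `2 * B` makes the left side nonnegative, so the case `d = 0` is vacuous.
  have key : ∀ d : ℕ, ∀ k l, p l - p k + 2 * B < d → ∀ v ∈ M.nilSpace i j,
      M.T k l v ∈ M.nilSpace i j := by
    intro d
    induction d with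
    | zero =>
      intro k l h
      have := hB k
      have := hB l
      push_cast at h
      omega
    | succ d ih =>
      intro k l hkl v hv
      rw [mem_nilSpace] at hv
      obtain ⟨N, hN⟩ := hv
      induction N generalizing v with
      | zero =>
        have : v = 0 := by simpa using hN
        simp [this]
      | succ N ihN =>
        have hv : v ∈ M.nilSpace i j := mem_nilSpace.2 ⟨_, hN⟩
        rw [pow_succ, Module.End.mul_apply] at hN
        apply mem_nilSpace_of_T
        push_cast at hkl
        refine M.T_T_mem (ihN _ hN) ?_ ?_ ?_ ?_
        · rintro rfl
          exact ih _ _ (by omega) v hv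
        · rintro rfl
          exact ih _ _ (by omega) v hv
        · rintro rfl
          rw [hp.anti] at hkl
          exact ih _ _ (by rw [hp.anti]; omega) v hv
        · rintro rfl
          rw [hp.anti] at hkl
          exact ih _ _ (by rw [hp.anti]; omega) v hv
  have h1 := hB k
  have h2 := hB l
  exact key (4 * B + 1).toNat k l (by omega) v hv

/-- An even operator preserves both parts, so a power that kills a vector kills its two components
separately. -/
theorem nilSpace_graded (M : OspModule m n V) {i j : Idx m n} (hpar : parity i = parity j) :
    M.nilSpace i j = (M.nilSpace i j ⊓ M.part 0) ⊔ (M.nilSpace i j ⊓ M.part 1) := by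
  have h2 : ∀ a b : ZMod 2, a + a + b = b := by decide
  have hpow : ∀ (N : ℕ) b v, v ∈ M.part b → (M.T i j ^ N) v ∈ M.part b := by
    intro N b v hv
    induction N with
    | zero => simpa using hv
    | succ N ih =>
      rw [pow_succ', Module.End.mul_apply]
      have := M.T_mem_part i j ih
      rwa [hpar, h2] at this
  apply le_antisymm
  · intro v hv
    obtain ⟨N, hN⟩ := mem_nilSpace.1 hv
    have htop : v ∈ M.part 0 ⊔ M.part 1 := by
      rw [M.isCompl.sup_eq_top]; trivial
    obtain ⟨v0, h0, v1, h1, rfl⟩ := Submodule.mem_sup.1 htop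
    rw [map_add] at hN
    have e : (M.T i j ^ N) v0 = 0 := by
      refine (Submodule.disjoint_def.1 M.isCompl.disjoint) _ (hpow N 0 v0 h0) ?_
      rw [eq_neg_of_add_eq_zero_left hN]
      exact Submodule.neg_mem _ (hpow N 1 v1 h1)
    have e1 : (M.T i j ^ N) v1 = 0 := by rwa [e, zero_add] at hN
    exact Submodule.add_mem_sup ⟨mem_nilSpace.2 ⟨N, e⟩, h0⟩ ⟨mem_nilSpace.2 ⟨N, e1⟩, h1⟩
  · exact sup_le inf_le_left inf_le_left

theorem IsIrreducible.locNil_T {M : OspModule m n V} (hM : M.IsIrreducible)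
    {p : Idx m n → ℤ} (hp : IsOrder p) {i j : Idx m n} (hij : p j < p i)
    (hpar : parity i = parity j) {u : V} (h0 : u ≠ 0) (hu : ∃ N : ℕ, (M.T i j ^ N) u = 0) :
    LocNil (M.T i j) := by
  have := hM.eq_top (M.nilSpace_graded hpar) (fun k l v hv => M.T_mem_nilSpace hp hij k l hv)
    (mem_nilSpace.2 hu) h0
  intro v
  apply mem_nilSpace.1
  rw [this]
  trivial

/-- Lowering words in `u` span `V`. The degree `p i - p j` is positive on lowering operators and
additive under brackets, so their supercommutators have strictly larger degree, as
`exists_finiteDimensional_stable` requires. -/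
theorem IsIrreducible.finiteDimensional {M : OspModule m n V} (hM : M.IsIrreducible)
    {p : Idx m n → ℤ} (hp : IsOrder p) {u : V} {w : Idx m n → ℂ} {a : ZMod 2} (ha : u ∈ M.part a)
    (hw : M.IsWt w u) (hs : M.IsSing p u) (h0 : u ≠ 0)
    (hnil : ∀ i j, p j < p i → LocNil (M.T i j)) : FiniteDimensional ℂ V := by
  classical
  obtain ⟨W, hfd, hu, hW⟩ := exists_finiteDimensional_stable
    (Finset.univ.filter fun q : Idx m n × Idx m n => p q.2 < p q.1) (fun q => M.T q.1 q.2)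
    (fun q => p q.1 - p q.2) (fun q hq => hnil _ _ (by simpa using hq)) (by
      rintro ⟨i, j⟩ hij ⟨k, l⟩ hkl
      have hij : p j < p i := by simpa using hij
      have hkl : p l < p k := by simpa using hkl
      refine ⟨sgn ((parity i + parity j) * (parity k + parity l)), ?_⟩
      have hmem : ∀ (c : ℂ) (P : Prop) [Decidable P] (a b : Idx m n),
          (P → p i - p j + (p k - p l) = p a - p b) → (c * if P then 1 else 0) • M.T a b ∈
          Submodule.span ℂ ((fun q : Idx m n × Idx m n => M.T q.1 q.2) ''
            {q | q ∈ (Finset.univ.filter fun q : Idx m n × Idx m n => p q.2 < p q.1) ∧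
              p i - p j < p q.1 - p q.2 ∧ p k - p l < p q.1 - p q.2}) := by
        intro c P _ a b h
        split_ifs with hP
        · refine Submodule.smul_mem _ _ (Submodule.subset_span ⟨(a, b), ⟨?_, ?_, ?_⟩, rfl⟩)
          · have := h hP
            simp only [Finset.mem_filter, Finset.mem_univ, true_and]
            omega
          · have := h hP
            change p i - p j < p a - p b
            omega
          · have := h hP
            change p k - p l < p a - p b
            omega
        · simp
      dsimp only
      rw [T_mul_T, add_sub_cancel_left]
      refine Submodule.add_mem _ (Submodule.sub_mem _ (Submodule.sub_mem _ ?_ ?_) ?_) ?_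
      · have := hmem 1 (j = k) i l (by rintro rfl; omega)
        rwa [one_mul] at this
      · exact hmem _ _ k j (by rintro rfl; omega)
      · exact hmem _ _ (dual j) l (by rintro rfl; rw [hp.anti, hp.anti]; omega)
      · exact hmem _ _ k (dual i) (by rintro rfl; rw [hp.anti, hp.anti]; omega)) u
  have hle : M.lowSpan p u ≤ W := M.lowSpan_le hu fun i j hij x hx => hW (i, j) (by simpa using hij) x hx
  rw [hM.lowSpan_eq_top hp ha hw hs h0, top_le_iff] at hle
  rw [hle] at hfd
  exact Module.finite_def.2 ((Submodule.fg_iff_finiteDimensional _).2 hfd)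

end OspModule
end OSP

/-! ### Rank-one relations between opposite root vectors. -/

namespace OSP
namespace OspModule

variable {m n : ℕ} {V : Type*} [AddCommGroup V] [Module ℂ V]

theorem eq_zero_of_eq_neg {f : Module.End ℂ V} (h : f = -f) : f = 0 := by
  have h2 : (2 : ℂ) • f = 0 := by
    rw [two_smul]
    nth_rewrite 1 [h]
    exact neg_add_cancel f
  exact (smul_eq_zero.1 h2).resolve_left two_ne_zero

theorem zmod_two_add_self (a : ZMod 2) : a + a = 0 := by revert a; decide

theorem IsOrder.zero {p : Idx m n → ℤ} (hp : IsOrder p) : p zeroIdx = 0 := by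
  have := hp.anti zeroIdx
  rw [dual_zeroIdx] at this
  omega

theorem parity_zeroIdx : parity (zeroIdx : Idx m n) = 0 := rfl

theorem T_flip_apply_eq_zero (M : OspModule m n V) {i j : Idx m n} {v : V}
    (h : M.T i j v = 0) : M.T (dual j) (dual i) v = 0 := by
  rw [T_flip, dual_dual, dual_dual, LinearMap.smul_apply, h, smul_zero]

theorem T_dual_self (M : OspModule m n V) (i : Idx m n) :
    M.T (dual i) (dual i) = - M.T i i := by
  rw [T_flip, flipSign_self, dual_dual, neg_smul, one_smul]

theorem T_zero_zero (M : OspModule m n V) : M.T zeroIdx zeroIdx = 0 := by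
  have h := M.T_dual_self zeroIdx
  rw [dual_zeroIdx] at h
  exact eq_zero_of_eq_neg h

theorem T_self_dual_eq_zero (M : OspModule m n V) {i : Idx m n} (h : parity i = 0) :
    M.T i (dual i) = 0 := by
  have h1 := M.T_flip i (dual i)
  rw [flipSign_self_dual, h, sgn_zero, dual_dual, neg_smul, one_smul] at h1
  exact eq_zero_of_eq_neg h1

theorem T_opp (M : OspModule m n V) {i j : Idx m n} (hd : i ≠ dual j) (v : V) :
    M.T j i (M.T i j v) = sgn (parity i + parity j) • M.T i j (M.T j i v) + (M.T j j v
      - sgn (parity i + parity j) • M.T i i v) := by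
  have h : ∀ a b : ZMod 2, (b + a) * (a + b) = a + b := by decide
  rw [T_T, h]
  have h1 : dual i ≠ j := fun e => hd (dual_eq_iff.1 e)
  simp [h1, hd.symm]

theorem T_opp_even (M : OspModule m n V) {i j : Idx m n} (hd : i ≠ dual j)
    (hpar : parity i = parity j) (v : V) :
    M.T j i (M.T i j v) = M.T i j (M.T j i v) + (M.T j j - M.T i i) v := by
  rw [T_opp M hd, hpar, zmod_two_add_self, sgn_zero, one_smul, one_smul, LinearMap.sub_apply]

theorem T_opp_odd (M : OspModule m n V) {i j : Idx m n} (hd : i ≠ dual j)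
    (hpar : parity i + parity j = 1) (v : V) :
    M.T j i (M.T i j v) = - M.T i j (M.T j i v) + (M.T j j + M.T i i) v := by
  rw [T_opp M hd, hpar, sgn_one, neg_smul, neg_smul, one_smul, one_smul, LinearMap.add_apply]
  abel

/-- For odd `j` the root matrices at `(j, dual j)` and `(dual j, j)` are twice elementary matrices,
whence the 4. -/
theorem T_opp_dual (M : OspModule m n V) {j : Idx m n} (hj : parity j = 1) (v : V) :
    M.T j (dual j) (M.T (dual j) j v) = M.T (dual j) j (M.T j (dual j) v)
      + ((4 : ℂ) • M.T j j) v := by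
  rw [T_T, flipSign_self_dual, parity_dual, zmod_two_add_self, hj, sgn_one]
  simp [sgn_zero, T_dual_self]
  module

theorem T_sub_T (M : OspModule m n V) (i j : Idx m n) (v : V) :
    (M.T j j - M.T i i) (M.T i j v) = M.T i j ((M.T j j - M.T i i) v)
      - ((rootWt i j i - rootWt i j j : ℤ) : ℂ) • M.T i j v := by
  rw [LinearMap.sub_apply, T_diag_T, T_diag_T, LinearMap.sub_apply, map_sub]
  push_cast
  module

theorem rootWt_long {i j : Idx m n} (hij : i ≠ j) (hd : i ≠ dual j) (hi : i ≠ zeroIdx)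
    (hj : j ≠ zeroIdx) : rootWt i j i - rootWt i j j = 2 := by
  have h1 : dual i ≠ j := fun e => hd (dual_eq_iff.1 e)
  simp [rootWt, hij, hij.symm, hd.symm, h1, dual_ne_self hi, dual_ne_self hj]

theorem rootWt_short {i : Idx m n} (hi : i ≠ zeroIdx) :
    rootWt i zeroIdx i - rootWt i zeroIdx zeroIdx = 1 := by
  have h1 : dual i ≠ zeroIdx := fun e => hi (dual_eq_iff.1 e)
  have h2 : dual (zeroIdx : Idx m n) = zeroIdx := rfl
  simp only [rootWt, dual_ne_self hi, hi, h1, h2, hi.symm, if_true, if_false]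
  norm_num

theorem rootWt_short' {j : Idx m n} (hj : j ≠ zeroIdx) :
    rootWt zeroIdx j zeroIdx - rootWt zeroIdx j j = 1 := by
  have h1 : dual j ≠ zeroIdx := fun e => hj (dual_eq_iff.1 e)
  have h2 : dual (zeroIdx : Idx m n) = zeroIdx := rfl
  simp only [rootWt, dual_ne_self hj, hj, h1, h2, hj.symm, if_true, if_false]
  norm_num

theorem IsWt.zeroIdx {M : OspModule m n V} {w : Idx m n → ℂ} {u : V} (hw : M.IsWt w u)
    (h0 : u ≠ 0) : w zeroIdx = 0 := by
  have := hw OSP.zeroIdx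
  rw [T_zero_zero, LinearMap.zero_apply] at this
  exact (smul_eq_zero.1 this.symm).resolve_right h0

theorem IsWt.dual {M : OspModule m n V} {w : Idx m n → ℂ} {u : V} (hw : M.IsWt w u)
    (h0 : u ≠ 0) (i : Idx m n) : w (dual i) = - w i := by
  have := hw (OSP.dual i)
  rw [T_dual_self, LinearMap.neg_apply, hw i, ← neg_smul] at this
  exact (smul_left_injective ℂ h0 this).symm

theorem IsWt.sub {M : OspModule m n V} {w : Idx m n → ℂ} {u : V} (hw : M.IsWt w u)
    (i j : Idx m n) : (M.T j j - M.T i i) u = (w j - w i) • u := by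
  rw [LinearMap.sub_apply, hw, hw, sub_smul]

/-! ### Inequalities forced by finite dimension. -/

section dominance

variable [FiniteDimensional ℂ V] {M : OspModule m n V} {p : Idx m n → ℤ} {w : Idx m n → ℂ} {u : V}

theorem exists_nat_long (hs : M.IsSing p u) (hw : M.IsWt w u) (h0 : u ≠ 0) {i j : Idx m n}
    (hij : p j < p i) (hd : i ≠ dual j) (hi : i ≠ zeroIdx) (hj : j ≠ zeroIdx)
    (hpar : parity i = parity j) : ∃ N : ℕ, w j - w i = N := by
  have hne : i ≠ j := by rintro rfl; exact lt_irrefl _ hij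
  obtain ⟨N, hN⟩ := exists_nat_of_finiteDimensional (e := M.T j i) (f := M.T i j)
    (h := M.T j j - M.T i i) (κ := 2) two_ne_zero (M.T_opp_even hd hpar) (fun v => by
      rw [T_sub_T, rootWt_long hne hd hi hj]; norm_num) (hw.sub i j) (hs _ _ hij) h0
  exact ⟨N, by rw [hN]; ring⟩

/-- Only half-integers come out here, because spin weights also satisfy this condition. -/
theorem exists_nat_short (hp : IsOrder p) (hs : M.IsSing p u) (hw : M.IsWt w u) (h0 : u ≠ 0)
    {j : Idx m n} (hj : p j < 0) (hpar : parity j = 0) : ∃ N : ℕ, w j = N / 2 := by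
  have hne : j ≠ zeroIdx := by rintro rfl; rw [IsOrder.zero hp] at hj; exact lt_irrefl _ hj
  have hd : zeroIdx ≠ dual j := by
    intro e
    exact hne (by rw [← dual_dual j, ← e]; rfl)
  obtain ⟨N, hN⟩ := exists_nat_of_finiteDimensional (e := M.T j zeroIdx) (f := M.T zeroIdx j)
    (h := M.T j j - M.T zeroIdx zeroIdx) (κ := 1) one_ne_zero
    (M.T_opp_even hd (by rw [hpar, parity_zeroIdx])) (fun v => by
      rw [T_sub_T, rootWt_short' hne]; norm_num) (hw.sub _ j)
    (hs _ _ (by rwa [IsOrder.zero hp])) h0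
  rw [hw.zeroIdx h0] at hN
  exact ⟨N, by linear_combination hN⟩

theorem exists_nat_odd (hp : IsOrder p) (hs : M.IsSing p u) (hw : M.IsWt w u) (h0 : u ≠ 0)
    {j : Idx m n} (hj : p j < 0) (hpar : parity j = 1) : ∃ N : ℕ, w j = N := by
  have hne : j ≠ zeroIdx := by rintro rfl; rw [IsOrder.zero hp] at hj; exact lt_irrefl _ hj
  have hroot : rootWt (dual j) j j = -2 := by
    simp [rootWt, (dual_ne_self hne).symm, dual_ne_self hne]
  -- `κ = 8` is the 4 of `T_opp_dual` times the value 2 of the doubled root, so `4 * w j = 8 * N /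
  -- 2`.
  obtain ⟨N, hN⟩ := exists_nat_of_finiteDimensional (e := M.T j (dual j)) (f := M.T (dual j) j)
    (h := (4 : ℂ) • M.T j j) (κ := 8) (c := 4 * w j) (by norm_num)
    (M.T_opp_dual hpar) (fun v => by
      rw [LinearMap.smul_apply, T_diag_T, hroot, LinearMap.smul_apply, map_smul]
      push_cast
      module) (by rw [LinearMap.smul_apply, hw, smul_smul])
    (hs _ _ (by rw [hp.anti]; omega)) h0
  exact ⟨N, by linear_combination hN / 4⟩

end dominance

/-! ### Simple roots: vanishing of powers and odd reflections. -/

section simple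

variable {M : OspModule m n V} {p : Idx m n → ℤ} {w : Idx m n → ℂ} {u : V}

/-- Subtracting a simple root from another positive root leaves a positive root or none, so
commuting `T a b` past `T i j` yields raising operators that are again not excluded. For `j =
zeroIdx` the doubled root `(dual i, i)` has to be excluded too, since subtracting the simple root
from it gives the simple root back. -/
theorem T_pow_eq_zero_of_ne (hp : IsOrder p) (hs : M.IsSing p u) {i j : Idx m n}
    (hij : p i = p j + 1) (hi : i ≠ zeroIdx) (k : ℕ) :
    ∀ a b, p a < p b → (a, b) ≠ (j, i) → (a, b) ≠ (dual i, dual j) →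
      (j = zeroIdx → (a, b) ≠ (dual i, i)) → M.T a b ((M.T i j ^ k) u) = 0 := by
  have hji : i ≠ j := by rintro rfl; omega
  induction k with
  | zero => exact fun a b hab _ _ _ => hs a b hab
  | succ k ih =>
    intro a b hab h1 h2 h3
    have hj : j = dual j → j = zeroIdx := fun e => by
      by_contra h
      exact dual_ne_self h e.symm
    have hi' : i ≠ dual i := (dual_ne_self hi).symm
    rw [pow_succ', Module.End.mul_apply, ← Submodule.mem_bot ℂ]
    refine M.T_T_mem ?_ ?_ ?_ ?_ ?_
    · rw [ih a b hab h1 h2 h3]; simp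
    · rintro rfl
      have haj : a ≠ j := by rintro rfl; exact h1 rfl
      have : p a ≠ p j := fun e => haj (hp.inj e)
      refine ih a j (by omega) (fun e => haj (Prod.mk.inj e).1) (fun e => ?_) (fun e e' => ?_)
      · obtain ⟨e1, e2⟩ := Prod.mk.inj e
        exact h3 (hj e2) (by rw [e1])
      · exact hji (Prod.mk.inj e').2.symm
    · rintro rfl
      have hbi : b ≠ i := by rintro rfl; exact h1 rfl
      have : p b ≠ p i := fun e => hbi (hp.inj e)
      exact ih i b (by omega) (fun e => hji (Prod.mk.inj e).1) (fun e => hi' (Prod.mk.inj e).1)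
        (fun _ e => hi' (Prod.mk.inj e).1)
    · intro e
      obtain rfl : a = dual i := dual_eq_iff.1 e
      have hbj : dual b ≠ j := by rintro rfl; exact h2 (by rw [dual_dual])
      have : p (dual b) ≠ p j := fun e => hbj (hp.inj e)
      have e1 := hp.anti b
      have e2 := hp.anti i
      refine ih (dual b) j (by omega) (fun e => hbj (Prod.mk.inj e).1) (fun e => ?_)
        (fun _ e => hji (Prod.mk.inj e).2.symm)
      obtain ⟨e1, e2⟩ := Prod.mk.inj e
      exact h3 (hj e2) (by rw [dual_inj.1 e1])
    · intro e
      obtain rfl : b = dual j := dual_eq_iff.1 e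
      have hai : dual a ≠ i := by rintro rfl; exact h2 (by rw [dual_dual])
      have : p (dual a) ≠ p i := fun e => hai (hp.inj e)
      have e1 := hp.anti a
      have e2 := hp.anti j
      exact ih i (dual a) (by omega) (fun e => hji (Prod.mk.inj e).1)
        (fun e => hi' (Prod.mk.inj e).1) (fun _ e => hi' (Prod.mk.inj e).1)

theorem ne_dual_of_eq_add_one (hp : IsOrder p) {i j : Idx m n} (hij : p i = p j + 1) :
    i ≠ dual j := by
  rintro rfl
  rw [hp.anti] at hij
  omega

/-- Lowering operators of even simple roots act nilpotently on a dominant singular vector. -/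
theorem IsIrreducible.pow_even_simple_eq_zero (hM : M.IsIrreducible) (hp : IsOrder p)
    (hs : M.IsSing p u) (hw : M.IsWt w u) {c : ZMod 2} (hc : u ∈ M.part c) {i j : Idx m n}
    (hij : p i = p j + 1) (hi : i ≠ zeroIdx) (hpar : parity i = parity j) (N : ℕ)
    (hN : w j - w i = ((rootWt i j i - rootWt i j j : ℤ) : ℂ) * N / 2) :
    (M.T i j ^ (N + 1)) u = 0 := by
  have hd := ne_dual_of_eq_add_one hp hij
  refine hM.pow_eq_zero hp hc hw (by omega) (Nat.succ_ne_zero N) ?_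
  have he : M.T j i ((M.T i j ^ (N + 1)) u) = 0 := by
    rw [raise_pow (M.T_opp_even hd hpar) (M.T_sub_T i j) (hw.sub i j) (hs _ _ (by omega)), hN]
    simp
  intro a b hab
  by_cases h1 : (a, b) = (j, i)
  · obtain ⟨rfl, rfl⟩ := Prod.mk.inj h1
    exact he
  by_cases h2 : (a, b) = (dual i, dual j)
  · obtain ⟨rfl, rfl⟩ := Prod.mk.inj h2
    exact M.T_flip_apply_eq_zero he
  -- Here `i` is even, so twice the short root is not a root and its root vector vanishes.
  by_cases h3 : j = zeroIdx ∧ (a, b) = (dual i, i)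
  · obtain ⟨h4, h5⟩ := h3
    obtain ⟨rfl, rfl⟩ : a = dual i ∧ b = i := Prod.mk.inj h5
    have h6 : parity (dual b) = 0 := by rw [parity_dual, hpar, h4, parity_zeroIdx]
    have := M.T_self_dual_eq_zero h6
    rw [dual_dual] at this
    rw [this, LinearMap.zero_apply]
  · exact T_pow_eq_zero_of_ne hp hs hij hi _ a b hab h1 h2 (fun h4 h5 => h3 ⟨h4, h5⟩)

/-- A non-isotropic odd root vector squares, up to a nonzero scalar, to the root vector of the
doubled root. -/
theorem T_sq_short (M : OspModule m n V) {i : Idx m n} (hi : parity i = 1) (v : V) :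
    (2 : ℂ) • M.T zeroIdx i (M.T zeroIdx i v) =
      - flipSign zeroIdx i • M.T (dual i) i v := by
  have h0 : i ≠ zeroIdx := by rintro rfl; rw [parity_zeroIdx] at hi; exact absurd hi (by decide)
  have := M.T_T zeroIdx i zeroIdx i v
  rw [parity_zeroIdx, hi, zero_add, mul_one, sgn_one, dual_zeroIdx, if_neg h0, if_neg h0.symm,
    if_neg (dual_ne_self h0), if_pos rfl] at this
  rw [two_smul]
  nth_rewrite 1 [this]
  module

theorem T_sq_short' (M : OspModule m n V) {i : Idx m n} (hi : parity i = 1) (v : V) :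
    (2 : ℂ) • M.T i zeroIdx (M.T i zeroIdx v) =
      - flipSign i zeroIdx • M.T i (dual i) v := by
  have h0 : i ≠ zeroIdx := by rintro rfl; rw [parity_zeroIdx] at hi; exact absurd hi (by decide)
  have := M.T_T i zeroIdx i zeroIdx v
  rw [parity_zeroIdx, hi, add_zero, mul_one, sgn_one, dual_zeroIdx, if_neg h0, if_neg h0.symm,
    if_neg (dual_ne_self h0), if_pos rfl] at this
  rw [two_smul]
  nth_rewrite 1 [this]
  module

/-- The `osp(1|2)` analogue of `raise_pow`: the two odd operators anticommute to a Cartan element,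
so the coefficient depends on the parity of the exponent. At `k = 0` the truncated exponent `2 * k -
1` comes with coefficient 0. -/
theorem raise_pow_odd (hs : M.IsSing p u) (hw : M.IsWt w u) (hp : IsOrder p) {i : Idx m n}
    (hi : p i = 1) (hpar : parity i = 1) (k : ℕ) :
    M.T zeroIdx i ((M.T i zeroIdx ^ (2 * k)) u) = (k : ℂ) • (M.T i zeroIdx ^ (2 * k - 1)) u ∧
    M.T zeroIdx i ((M.T i zeroIdx ^ (2 * k + 1)) u) = (w i + k) • (M.T i zeroIdx ^ (2 * k)) u := by
  have h0 : i ≠ zeroIdx := by rintro rfl; rw [parity_zeroIdx] at hpar; exact absurd hpar (by decide)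
  have hd : i ≠ dual zeroIdx := h0
  have hstep : ∀ N : ℕ, M.T zeroIdx i ((M.T i zeroIdx ^ (N + 1)) u) =
      - M.T i zeroIdx (M.T zeroIdx i ((M.T i zeroIdx ^ N) u)) + (w i + N) • (M.T i zeroIdx ^ N) u := by
    intro N
    rw [pow_succ', Module.End.mul_apply, T_opp_odd M hd (by rw [hpar, parity_zeroIdx, add_zero]),
      LinearMap.add_apply, T_zero_zero, LinearMap.zero_apply, zero_add, hw.pow i zeroIdx N i]
    have : rootWt i zeroIdx i = 1 := by
      have h1 : dual i ≠ zeroIdx := fun e => h0 (dual_eq_iff.1 e)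
      simp only [rootWt, dual_ne_self h0, h0, h1, if_true, if_false]
      norm_num
    dsimp only
    rw [this]
    norm_num
  induction k with
  | zero =>
    have hu := hs zeroIdx i (by rw [IsOrder.zero hp]; omega)
    refine ⟨by simpa using hu, ?_⟩
    have := hstep 0
    simpa [hu] using this
  | succ k ih =>
    have e1 : M.T zeroIdx i ((M.T i zeroIdx ^ (2 * k + 1 + 1)) u)
        = ((k + 1 : ℕ) : ℂ) • (M.T i zeroIdx ^ (2 * k + 1)) u := by
      rw [hstep, ih.2, map_smul, ← Module.End.mul_apply, ← pow_succ']
      push_cast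
      module
    refine ⟨e1, ?_⟩
    rw [hstep, show 2 * (k + 1) = 2 * k + 1 + 1 by ring, e1, map_smul, ← Module.End.mul_apply,
      ← pow_succ']
    push_cast
    module

/-- The lowering operator of a non-isotropic odd simple root acts nilpotently on a dominant
singular vector. -/
theorem IsIrreducible.pow_odd_simple_eq_zero (hM : M.IsIrreducible) (hp : IsOrder p)
    (hs : M.IsSing p u) (hw : M.IsWt w u) {c : ZMod 2} (hc : u ∈ M.part c) {i : Idx m n}
    (hi : p i = 1) (hpar : parity i = 1) (N : ℕ) (hN : w i = - (N : ℂ)) :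
    (M.T i zeroIdx ^ (2 * N + 1)) u = 0 := by
  have h0 : i ≠ zeroIdx := by rintro rfl; rw [parity_zeroIdx] at hpar; exact absurd hpar (by decide)
  have hz := IsOrder.zero hp
  refine hM.pow_eq_zero hp hc hw (by omega) (Nat.succ_ne_zero _) ?_
  have he : M.T zeroIdx i ((M.T i zeroIdx ^ (2 * N + 1)) u) = 0 := by
    rw [(raise_pow_odd hs hw hp hi hpar N).2, hN, neg_add_cancel, zero_smul]
  intro a b hab
  by_cases h1 : (a, b) = (zeroIdx, i)
  · obtain ⟨rfl, rfl⟩ := Prod.mk.inj h1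
    exact he
  by_cases h2 : (a, b) = (dual i, dual zeroIdx)
  · obtain ⟨rfl, rfl⟩ := Prod.mk.inj h2
    exact M.T_flip_apply_eq_zero he
  by_cases h3 : (a, b) = (dual i, i)
  · obtain ⟨rfl, rfl⟩ := Prod.mk.inj h3
    have := M.T_sq_short hpar ((M.T b zeroIdx ^ (2 * N + 1)) u)
    rw [he, map_zero, smul_zero] at this
    exact (smul_eq_zero.1 this.symm).resolve_left (neg_ne_zero.2 (flipSign_ne_zero _ _))
  · exact T_pow_eq_zero_of_ne hp hs (by omega) h0 _ a b hab h1 h2 (fun _ h5 => h3 h5)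

/-- Isotropic odd roots: twice the root is not a root, so the supercommutator of the root vector
with itself, which is twice its square, vanishes. -/
theorem T_mul_self_eq_zero (M : OspModule m n V) {i j : Idx m n} (hi : i ≠ zeroIdx)
    (hj : j ≠ zeroIdx) (hpar : parity i + parity j = 1) : M.T i j * M.T i j = 0 := by
  have hne : i ≠ j := by
    rintro rfl
    rw [zmod_two_add_self] at hpar
    exact absurd hpar (by decide)
  have h := M.T_mul_T i j i j
  rw [hpar, mul_one, sgn_one, if_neg hne.symm, if_neg hne, if_neg (dual_ne_self hi),
    if_neg (dual_ne_self hj)] at h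
  simp only [mul_zero, zero_smul, sub_zero, add_zero, neg_smul, one_smul] at h
  exact eq_zero_of_eq_neg h

/-- Odd reflections. -/
theorem IsIrreducible.odd_reflection (hM : M.IsIrreducible) (hp : IsOrder p) {p' : Idx m n → ℤ}
    (hs : M.IsSing p u) (hw : M.IsWt w u) {c : ZMod 2} (hc : u ∈ M.part c) (h0 : u ≠ 0)
    {i j : Idx m n} (hij : p i = p j + 1) (hi : i ≠ zeroIdx) (hj : j ≠ zeroIdx)
    (hpar : parity i + parity j = 1)
    (hp' : ∀ a b, p' a < p' b → (p a < p b ∧ (a, b) ≠ (j, i) ∧ (a, b) ≠ (dual i, dual j)) ∨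
      (a, b) = (i, j) ∨ (a, b) = (dual j, dual i)) :
    ∃ (u' : V) (c' : ZMod 2), u' ≠ 0 ∧ u' ∈ M.part c' ∧ M.IsSing p' u' ∧
      M.IsWt (fun k => w k + (if w i + w j = 0 then 0 else rootWt i j k : ℤ)) u' := by
  have hd := ne_dual_of_eq_add_one hp hij
  have hrest : ∀ a b, p a < p b → (a, b) ≠ (j, i) → (a, b) ≠ (dual i, dual j) →
      M.T a b (M.T i j u) = 0 := fun a b hab h1 h2 => by
    have := T_pow_eq_zero_of_ne hp hs hij hi 1 a b hab h1 h2 (fun h => absurd h hj)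
    rwa [pow_one] at this
  have he : M.T j i (M.T i j u) = (w i + w j) • u := by
    rw [T_opp_odd M hd hpar, hs _ _ (by omega), map_zero, neg_zero, zero_add, LinearMap.add_apply,
      hw, hw, ← add_smul, add_comm]
  by_cases hz : w i + w j = 0
  -- The lowered vector is singular for the old order, hence zero, so `u` is already singular for
  -- the new one.
  · have hfu : M.T i j u = 0 := by
      have := hM.pow_eq_zero hp hc hw (i := i) (j := j) (by omega) one_ne_zero (by
        rw [pow_one]
        intro a b hab
        by_cases h1 : (a, b) = (j, i)
        · obtain ⟨rfl, rfl⟩ := Prod.mk.inj h1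
          rw [he, hz, zero_smul]
        by_cases h2 : (a, b) = (dual i, dual j)
        · obtain ⟨rfl, rfl⟩ := Prod.mk.inj h2
          refine M.T_flip_apply_eq_zero ?_
          rw [he, hz, zero_smul]
        exact hrest a b hab h1 h2)
      rwa [pow_one] at this
    refine ⟨u, c, h0, hc, fun a b hab => ?_, fun k => ?_⟩
    · rcases hp' a b hab with h | h | h
      · exact hs _ _ h.1
      · obtain ⟨rfl, rfl⟩ := Prod.mk.inj h
        exact hfu
      · obtain ⟨rfl, rfl⟩ := Prod.mk.inj h
        exact M.T_flip_apply_eq_zero hfu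
    · dsimp only
      rw [if_pos hz, Int.cast_zero, add_zero, hw]
  -- Now `he` shows that the lowered vector is nonzero. It is killed by the new raising operator,
  -- which squares to zero.
  · have hff : M.T i j (M.T i j u) = 0 := by
      rw [← Module.End.mul_apply, T_mul_self_eq_zero M hi hj hpar, LinearMap.zero_apply]
    refine ⟨M.T i j u, _, ?_, M.T_mem_part i j hc, fun a b hab => ?_, fun k => ?_⟩
    · intro h
      rw [h, map_zero] at he
      exact (smul_eq_zero.1 he.symm).elim hz h0
    · rcases hp' a b hab with h | h | h
      · exact hrest _ _ h.1 h.2.1 h.2.2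
      · obtain ⟨rfl, rfl⟩ := Prod.mk.inj h
        exact hff
      · obtain ⟨rfl, rfl⟩ := Prod.mk.inj h
        exact M.T_flip_apply_eq_zero hff
    · dsimp only
      rw [if_neg hz]
      exact hw.T i j k

end simple

end OspModule
end OSP

/-! ### Moving the label `1/2` past the integral labels. -/

namespace OSP

variable {m n : ℕ}

/-- The place of a label after the label `1/2` has been moved down past `k` integral labels. -/
def movedLevel (k : ℕ) : PIdx m n → ℤ
  | Sum.inl j => if (j : ℕ) < k then (m : ℤ) - (j : ℕ) + 1 else (m : ℤ) - (j : ℕ)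
  | Sum.inr i => if (i : ℕ) = 0 then (m : ℤ) + 1 - k else (m : ℤ) + (i : ℕ) + 1

/-- The place of a basis index after the label `1/2` has been moved down past `k` integral
labels. -/
def movedPlace (k : ℕ) : Idx m n → ℤ
  | Sum.inl r => -movedLevel k r
  | Sum.inr (Sum.inl _) => 0
  | Sum.inr (Sum.inr r) => movedLevel k r

theorem movedPlace_zero : (movedPlace 0 : Idx m n → ℤ) = place := by
  have h : ∀ r : PIdx m n, movedLevel 0 r = level r := by
    rintro (j | i)
    · simp [movedLevel, level]
    · simp only [movedLevel, level]
      split_ifs with h <;> simp [h]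
  funext i
  rcases i with r | u | r
  · simp [movedPlace, place, h]
  · rfl
  · simp [movedPlace, place, h]

theorem movedLevel_pos {k : ℕ} (hk : k ≤ m) (r : PIdx m n) : 0 < movedLevel k r := by
  rcases r with j | i
  · have := j.2
    simp only [movedLevel]
    split_ifs <;> omega
  · simp only [movedLevel]
    split_ifs <;> omega

theorem movedLevel_injective (k : ℕ) :
    Function.Injective (movedLevel k : PIdx m n → ℤ) := by
  rintro (j | i) (j' | i') h
  · have := j.2
    have := j'.2
    simp only [movedLevel] at h
    congr 1
    apply Fin.ext
    split_ifs at h <;> omega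
  · have := j.2
    simp only [movedLevel] at h
    split_ifs at h <;> omega
  · have := j'.2
    simp only [movedLevel] at h
    split_ifs at h <;> omega
  · simp only [movedLevel] at h
    congr 1
    apply Fin.ext
    split_ifs at h <;> omega

theorem isOrder_movedPlace {k : ℕ} (hk : k ≤ m) : IsOrder (movedPlace k : Idx m n → ℤ) where
  inj := by
    rintro (r | u | r) (s | u' | s) h
    · simp only [movedPlace, neg_inj] at h
      rw [movedLevel_injective k h]
    · have := movedLevel_pos hk r
      simp only [movedPlace] at h
      omega
    · have := movedLevel_pos hk r
      have := movedLevel_pos hk s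
      simp only [movedPlace] at h
      omega
    · have := movedLevel_pos hk s
      simp only [movedPlace] at h
      omega
    · rfl
    · have := movedLevel_pos hk s
      simp only [movedPlace] at h
      omega
    · have := movedLevel_pos hk r
      have := movedLevel_pos hk s
      simp only [movedPlace] at h
      omega
    · have := movedLevel_pos hk r
      simp only [movedPlace] at h
      omega
    · simp only [movedPlace] at h
      rw [movedLevel_injective k h]
  anti := by
    rintro (r | u | r)
    · simp [movedPlace, dual]
    · simp [movedPlace, dual]
    · simp [movedPlace, dual]

theorem isOrder_place : IsOrder (place : Idx m n → ℤ) := by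
  rw [← movedPlace_zero]
  exact isOrder_movedPlace (Nat.zero_le m)

/-- The root comparison for two orders that differ by an adjacent transposition. -/
theorem lt_of_swap {p p' : Idx m n → ℤ} (hp : IsOrder p) (hp' : IsOrder p') {i j : Idx m n}
    (hpos : 0 < p j) (hij : p i = p j + 1) (h1 : p' i = p j) (h2 : p' j = p i)
    (h3 : ∀ a, a ≠ i → a ≠ j → a ≠ dual i → a ≠ dual j → p' a = p a) (a b : Idx m n)
    (hab : p' a < p' b) : (p a < p b ∧ (a, b) ≠ (j, i) ∧ (a, b) ≠ (dual i, dual j)) ∨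
      (a, b) = (i, j) ∨ (a, b) = (dual j, dual i) := by
  have hi := hp.anti i
  have hj := hp.anti j
  have hi' := hp'.anti i
  have hj' := hp'.anti j
  by_cases e1 : (a, b) = (i, j)
  · exact Or.inr (Or.inl e1)
  by_cases e2 : (a, b) = (dual j, dual i)
  · exact Or.inr (Or.inr e2)
  refine Or.inl ⟨?_, fun e => ?_, fun e => ?_⟩
  · have hcase : ∀ a, a = i ∨ a = j ∨ a = dual i ∨ a = dual j ∨
        (p' a = p a ∧ p a ≠ p i ∧ p a ≠ p j ∧ p a ≠ p (dual i) ∧ p a ≠ p (dual j)) := by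
      intro a
      by_cases ha1 : a = i
      · exact Or.inl ha1
      by_cases ha2 : a = j
      · exact Or.inr (Or.inl ha2)
      by_cases ha3 : a = dual i
      · exact Or.inr (Or.inr (Or.inl ha3))
      by_cases ha4 : a = dual j
      · exact Or.inr (Or.inr (Or.inr (Or.inl ha4)))
      exact Or.inr (Or.inr (Or.inr (Or.inr ⟨h3 a ha1 ha2 ha3 ha4, fun e => ha1 (hp.inj e),
        fun e => ha2 (hp.inj e), fun e => ha3 (hp.inj e), fun e => ha4 (hp.inj e)⟩)))
    rcases hcase a with rfl | rfl | rfl | rfl | ha <;>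
      rcases hcase b with rfl | rfl | rfl | rfl | hb <;>
      first
        | omega
        | exact absurd rfl e1
        | exact absurd rfl e2
  · obtain ⟨rfl, rfl⟩ := Prod.mk.inj e
    omega
  · obtain ⟨rfl, rfl⟩ := Prod.mk.inj e
    omega

/-- The coefficient at the label `1/2` along the sequence of odd reflections. -/
def reflSeq (ν : ℕ → ℤ) (d : ℤ) : ℕ → ℤ
  | 0 => d
  | k + 1 => if reflSeq ν d k + ν k = 0 then reflSeq ν d k else reflSeq ν d k - 1

/-- While `k < d` the sum `d - k + ν k` is positive and the value drops. From `k = d` on `ν k = 0`,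
so the value stays at 0. -/
theorem reflSeq_nonneg {ν : ℕ → ℤ} {d : ℤ} (hd : 0 ≤ d) {m : ℕ} (hν : ∀ j < m, 0 ≤ ν j)
    (h : ∀ j < m, d ≤ j → ν j = 0) : 0 ≤ reflSeq ν d m := by
  have key : ∀ k ≤ m, reflSeq ν d k = max (d - k) 0 := by
    intro k
    induction k with
    | zero => intro _; simp [reflSeq, hd]
    | succ k ih =>
      intro hk
      have h1 := hν k (by omega)
      have h2 := h k (by omega)
      rw [reflSeq, ih (by omega)]
      push_cast
      split_ifs with h3 <;> omega
  rw [key m le_rfl]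
  exact le_max_right _ _

/-- If `ν j > 0` with `d ≤ j`, then `ν` is positive up to `j`, so steps `0, …, d` all drop and the
value reaches `-1`; it can never rise again. -/
theorem eq_zero_of_reflSeq_nonneg {ν : ℕ → ℤ} {d : ℤ} (hd : 0 ≤ d) {m : ℕ}
    (hν : ∀ j < m, 0 ≤ ν j) (hanti : ∀ i j, i ≤ j → j < m → ν j ≤ ν i) (h : 0 ≤ reflSeq ν d m)
    {j : ℕ} (hj : j < m) (hdj : d ≤ j) : ν j = 0 := by
  by_contra hne
  have hpos : ∀ k ≤ j, 0 < ν k := by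
    intro k hk
    have h1 := hν j hj
    have h2 := hanti k j hk hj
    omega
  have h1 : ∀ k : ℕ, (k : ℤ) ≤ d → reflSeq ν d k = d - k := by
    intro k
    induction k with
    | zero => intro _; simp [reflSeq]
    | succ k ih =>
      intro hk
      push_cast at hk
      have := hpos k (by omega)
      rw [reflSeq, ih (by omega), if_neg (by omega)]
      push_cast
      ring
  have h2 : ∀ k, reflSeq ν d (k + 1) ≤ reflSeq ν d k := by
    intro k
    rw [reflSeq]
    split_ifs <;> omega
  have h3 : reflSeq ν d m ≤ reflSeq ν d (d.toNat + 1) :=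
    antitone_nat_of_succ_le h2 (by omega)
  have h4 := h1 d.toNat (by omega)
  have h5 := hpos d.toNat (by omega)
  rw [reflSeq, if_neg (by omega)] at h3
  omega

namespace OspModule

variable {V : Type*} [AddCommGroup V] [Module ℂ V]

/-- The singular vector obtained by moving the label `1/2` down to the first place. -/
theorem IsIrreducible.exists_movedPlace_isSing {M : OspModule m n V} (hM : M.IsIrreducible)
    {w : Idx m n → ℂ} {u : V} (hs : M.IsSing place u) (hw : M.IsWt w u) {c : ZMod 2}
    (hc : u ∈ M.part c) (h0 : u ≠ 0) (hn : 0 < n) {ν : ℕ → ℤ} {d : ℤ}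
    (hd : w (posIdx (Sum.inr ⟨0, hn⟩)) = -(d : ℂ))
    (hν : ∀ j : Fin m, w (posIdx (Sum.inl j)) = -(ν j : ℂ)) {k : ℕ} (hk : k ≤ m) :
    ∃ (u' : V) (c' : ZMod 2) (w' : Idx m n → ℂ), u' ≠ 0 ∧ u' ∈ M.part c' ∧
      M.IsSing (movedPlace k) u' ∧ M.IsWt w' u' ∧
      w' (posIdx (Sum.inr ⟨0, hn⟩)) = -(reflSeq ν d k : ℂ) ∧
      ∀ j : Fin m, k ≤ j → w' (posIdx (Sum.inl j)) = -(ν j : ℂ) := by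
  induction k with
  | zero =>
    exact ⟨u, c, w, h0, hc, by rwa [movedPlace_zero], hw, hd, fun j _ => hν j⟩
  | succ k ih =>
    obtain ⟨u', c', w', h0', hc', hs', hw', hd', hν'⟩ := ih (by omega)
    have hkm : k < m := by omega
    set i : Idx m n := posIdx (Sum.inr ⟨0, hn⟩) with hi
    set j : Idx m n := posIdx (Sum.inl ⟨k, hkm⟩) with hj
    have hp := isOrder_movedPlace (m := m) (n := n) (k := k) (by omega)
    have hp' := isOrder_movedPlace (m := m) (n := n) (k := k + 1) (by omega)
    have e1 : movedPlace k i = m + 1 - k := by simp [hi, movedPlace, movedLevel]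
    have e2 : movedPlace k j = m - k := by simp [hj, movedPlace, movedLevel]
    have e3 : movedPlace (k + 1) i = m - k := by simp [hi, movedPlace, movedLevel]
    have e4 : movedPlace (k + 1) j = m + 1 - k := by
      simp [hj, movedPlace, movedLevel]
      ring
    have hlev : ∀ r : PIdx m n, r ≠ Sum.inr ⟨0, hn⟩ → r ≠ Sum.inl ⟨k, hkm⟩ →
        movedLevel (k + 1) r = movedLevel k r := by
      rintro (a | a) h1 h2
      · have : (a : ℕ) ≠ k := fun e => h2 (by congr 1; exact Fin.ext e)
        simp only [movedLevel]
        split_ifs <;> omega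
      · have : (a : ℕ) ≠ 0 := fun e => h1 (by congr 1; exact Fin.ext e)
        simp [movedLevel, this]
    obtain ⟨u'', c'', h0'', hc'', hs'', hw''⟩ := hM.odd_reflection hp (p' := movedPlace (k + 1))
      hs' hw' hc' h0' (i := i) (j := j) (by omega) (by simp [hi]) (by simp [hj]) rfl
      (lt_of_swap hp hp' (by omega) (by omega) (by omega) (by omega) (by
        rintro (r | a | r) h1 h2 h3 h4
        · have := hlev r (fun e => h3 (by rw [e]; rfl)) (fun e => h4 (by rw [e]; rfl))
          simp [movedPlace, this]
        · rfl
        · have := hlev r (fun e => h1 (by rw [e])) (fun e => h2 (by rw [e]))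
          simp [movedPlace, this]))
    refine ⟨u'', c'', _, h0'', hc'', hs'', hw'', ?_, fun l hl => ?_⟩
    -- Weights are minus the coefficients, so adding the root weight 1 at `i` lowers `reflSeq` by
    -- one.
    · have e5 : w' i + w' j = 0 ↔ reflSeq ν d k + ν k = 0 := by
        rw [hd', hν' ⟨k, hkm⟩ le_rfl, ← neg_add, neg_eq_zero]
        exact_mod_cast Iff.rfl
      have e6 : rootWt i j i = 1 := by simp [rootWt, hi, hj, dual]
      rw [reflSeq, e6]
      by_cases h : reflSeq ν d k + ν k = 0
      · rw [if_pos (e5.2 h), if_pos h, hd']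
        simp
      · rw [if_neg (fun e => h (e5.1 e)), if_neg h, hd']
        push_cast
        ring
    · have hlk : l ≠ ⟨k, hkm⟩ := by rintro rfl; simp at hl
      have e6 : rootWt i j (posIdx (Sum.inl l)) = 0 := by simp [rootWt, hi, hj, dual, hlk]
      rw [hν' l (by omega), e6]
      simp

/-! ### From simple roots to all lowering operators. -/

section locNil

variable {M : OspModule m n V}

theorem locNil_flip {i j i' j' : Idx m n} (h : LocNil (M.T i j)) (hi : i' = dual j)
    (hj : j' = dual i) : LocNil (M.T i' j') := by
  rw [hi, hj, T_flip, dual_dual, dual_dual]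
  exact h.smul _

/-- `T i j` is the commutator of `T i k` and `T k j` and commutes with `T i k`. Since `T i k` is
even, supercommutators with it are ordinary commutators and `LocNil.comm` applies. -/
theorem locNil_chain {i j k : Idx m n} (hi : i ≠ zeroIdx) (hij : i ≠ j) (hki : k ≠ i)
    (hki' : k ≠ dual i) (hkj' : k ≠ dual j) (hpar : parity i = parity k)
    (hik : LocNil (M.T i k)) (hkj : LocNil (M.T k j)) : LocNil (M.T i j) := by
  have hkj'' : dual k ≠ j := fun e => hkj' (dual_eq_iff.1 e)
  refine hkj.comm hik ?_ ?_
  · rw [comm, T_mul_T, hpar, zmod_two_add_self, zero_mul, sgn_zero, one_smul]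
    simp [hij, hki'.symm, hkj'']
  · rw [comm, T_mul_T, hpar, zmod_two_add_self, zero_mul, sgn_zero, one_smul]
    simp [hij, hki, dual_ne_self hi, hkj'']

theorem locNil_dual {i j : Idx m n} (hi : parity i = 1) (hij : i ≠ j)
    (h1 : LocNil (M.T i (dual i))) (h2 : LocNil (M.T (dual i) j)) : LocNil (M.T i j) := by
  have h0 : i ≠ zeroIdx := by rintro rfl; rw [parity_zeroIdx] at hi; exact absurd hi (by decide)
  have h3 : LocNil ((2 : ℂ) • M.T i j) := by
    refine h2.comm h1 ?_ ?_
    · rw [comm, T_mul_T, parity_dual, zmod_two_add_self, zero_mul, sgn_zero, one_smul,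
        flipSign_self_dual, hi, sgn_one]
      simp [hij, two_smul]
    · rw [comm, mul_smul_comm, smul_mul_assoc, ← smul_sub, T_mul_T, parity_dual,
        zmod_two_add_self, zero_mul, sgn_zero, one_smul]
      simp [hij, dual_ne_self h0]
  have := h3.smul (2⁻¹ : ℂ)
  rwa [smul_smul, inv_mul_cancel₀ two_ne_zero, one_smul] at this

theorem locNil_self_dual {i : Idx m n} (hi : parity i = 1) (h : LocNil (M.T i zeroIdx)) :
    LocNil (M.T i (dual i)) := by
  have e : M.T i (dual i) = (-(flipSign i zeroIdx) * 2) • (M.T i zeroIdx * M.T i zeroIdx) := by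
    ext v
    rw [LinearMap.smul_apply, Module.End.mul_apply, ← smul_smul, M.T_sq_short' hi, smul_smul,
      neg_mul_neg, flipSign_mul_self, one_smul]
  rw [e]
  exact h.sq.smul _

theorem locNil_of_self_dual {i : Idx m n} (hi : parity i = 1) (h : LocNil (M.T i (dual i))) :
    LocNil (M.T i zeroIdx) := by
  have e : M.T i zeroIdx ^ 2 = (2⁻¹ * -(flipSign i zeroIdx)) • M.T i (dual i) := by
    ext v
    rw [LinearMap.smul_apply, ← smul_smul, ← M.T_sq_short' hi, smul_smul,
      inv_mul_cancel₀ two_ne_zero, one_smul, pow_two, Module.End.mul_apply]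
  intro v
  obtain ⟨N, hN⟩ := (h.smul (2⁻¹ * -(flipSign i zeroIdx))) v
  rw [← e, ← pow_mul] at hN
  exact ⟨_, hN⟩

/-- All lowering operators are locally nilpotent if those of the simple roots are. -/
theorem locNil_of_simple
    (h1 : ∀ j j' : Fin m, (j' : ℕ) = j + 1 →
      LocNil (M.T (posIdx (Sum.inl j)) (posIdx (Sum.inl j'))))
    (h2 : ∀ j : Fin m, (j : ℕ) + 1 = m → LocNil (M.T (posIdx (Sum.inl j)) zeroIdx))
    (h3 : ∀ i i' : Fin n, (i' : ℕ) = i + 1 →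
      LocNil (M.T (posIdx (Sum.inr i')) (posIdx (Sum.inr i))))
    (h4 : ∀ i : Fin n, (i : ℕ) = 0 → LocNil (M.T (posIdx (Sum.inr i)) zeroIdx))
    (i j : Idx m n) (hij : place j < place i) : LocNil (M.T i j) := by
  have c1 : ∀ (d : ℕ) (j : Fin m), (j : ℕ) + d + 1 = m →
      LocNil (M.T (posIdx (Sum.inl j)) zeroIdx) := by
    intro d
    induction d with
    | zero => exact fun j hj => h2 j (by omega)
    | succ d ih =>
      intro j hj
      have hj' : (j : ℕ) + 1 < m := by omega
      have hne : (⟨j + 1, hj'⟩ : Fin m) ≠ j := fun e => by have := congrArg Fin.val e; simp at this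
      exact locNil_chain (k := posIdx (Sum.inl ⟨j + 1, hj'⟩)) (by simp) (by simp) (by simp [hne])
        (by simp) (by simp) rfl (h1 _ _ rfl) (ih _ (by simp; omega))
  have c1' : ∀ j : Fin m, LocNil (M.T (posIdx (Sum.inl j)) zeroIdx) := fun j =>
    c1 (m - 1 - j) j (by have := j.2; omega)
  have c2 : ∀ (d : ℕ) (j j' : Fin m), (j' : ℕ) = j + d + 1 →
      LocNil (M.T (posIdx (Sum.inl j)) (posIdx (Sum.inl j'))) := by
    intro d
    induction d with
    | zero => exact fun j j' h => h1 j j' (by omega)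
    | succ d ih =>
      intro j j' h
      have hj' : (j : ℕ) + 1 < m := by have := j'.2; omega
      have hne : (⟨j + 1, hj'⟩ : Fin m) ≠ j := fun e => by have := congrArg Fin.val e; simp at this
      have hne' : j ≠ j' := by rintro rfl; omega
      exact locNil_chain (k := posIdx (Sum.inl ⟨j + 1, hj'⟩)) (by simp) (by simp [hne'])
        (by simp [hne]) (by simp) (by simp) rfl (h1 _ _ rfl) (ih _ _ (by simp; omega))
  have c3 : ∀ (d : ℕ) (i i' : Fin n), (i' : ℕ) = i + d + 1 →
      LocNil (M.T (posIdx (Sum.inr i')) (posIdx (Sum.inr i))) := by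
    intro d
    induction d with
    | zero => exact fun i i' h => h3 i i' (by omega)
    | succ d ih =>
      intro i i' h
      have hi' : (i : ℕ) + 1 < n := by have := i'.2; omega
      have hne : (⟨i + 1, hi'⟩ : Fin n) ≠ i' := fun e => by
        have := congrArg Fin.val e
        simp at this
        omega
      have hne' : i' ≠ i := by rintro rfl; omega
      exact locNil_chain (k := posIdx (Sum.inr ⟨i + 1, hi'⟩)) (by simp) (by simp [hne'])
        (by simp [hne]) (by simp) (by simp) rfl (ih _ _ (by simp; omega)) (h3 _ _ rfl)
  have c3' : ∀ i i' : Fin n, i < i' → LocNil (M.T (posIdx (Sum.inr i')) (posIdx (Sum.inr i))) :=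
    fun i i' h => c3 (i' - i - 1) i i' (by have : (i : ℕ) < i' := h; omega)
  -- For `m > 0` the root `-ε_{1/2}` is not simple in this order, and nilpotency of the isotropic
  -- simple root says nothing about it; hence the separate input `h4`.
  have c4 : ∀ i : Fin n, LocNil (M.T (posIdx (Sum.inr i)) zeroIdx) := by
    intro i
    by_cases hi : (i : ℕ) = 0
    · exact h4 i hi
    have hn : 0 < n := by have := i.2; omega
    have hne : (⟨0, hn⟩ : Fin n) ≠ i := by rintro rfl; simp at hi
    exact locNil_chain (k := posIdx (Sum.inr ⟨0, hn⟩)) (by simp) (by simp) (by simp [hne])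
      (by simp) (by simp) rfl (c3' _ _ (Fin.lt_def.2 (by simp; omega))) (h4 _ rfl)
  have c5 : ∀ i : Fin n, LocNil (M.T (posIdx (Sum.inr i)) (barIdx (Sum.inr i))) := fun i =>
    locNil_self_dual (i := posIdx (Sum.inr i)) rfl (c4 i)
  have c6 : ∀ i i' : Fin n, i < i' →
      LocNil (M.T (posIdx (Sum.inr i)) (barIdx (Sum.inr i'))) := fun i i' h =>
    locNil_dual (i := posIdx (Sum.inr i)) rfl (by simp) (c5 i) (locNil_flip (c3' i i' h) rfl rfl)
  have cpos : ∀ r s : PIdx m n, place (posIdx s) < place (posIdx r) →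
      LocNil (M.T (posIdx r) (posIdx s)) := by
    rintro (a | a) (b | b) h
    · simp only [place, level] at h
      exact c2 (b - a - 1) a b (by omega)
    -- Roots joining labels of different parity are isotropic, so their root vectors square to zero.
    · exact locNil_of_sq_eq_zero (M.T_mul_self_eq_zero (by simp) (by simp) rfl)
    · exact locNil_of_sq_eq_zero (M.T_mul_self_eq_zero (by simp) (by simp) rfl)
    · simp only [place, level] at h
      exact c3' b a (Fin.lt_def.2 (by omega))
  have czero : ∀ r : PIdx m n, LocNil (M.T (posIdx r) zeroIdx) := by
    rintro (a | a)
    · exact c1' a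
    · exact c4 a
  have cbar : ∀ r s : PIdx m n, LocNil (M.T (posIdx r) (barIdx s)) := by
    rintro (a | a) (b | b)
    · exact locNil_chain (k := zeroIdx) (by simp) (by simp) (by simp) (by simp) (by simp) rfl
        (c1' a) (locNil_flip (c1' b) rfl rfl)
    · exact locNil_of_sq_eq_zero (M.T_mul_self_eq_zero (by simp) (by simp) rfl)
    · exact locNil_of_sq_eq_zero (M.T_mul_self_eq_zero (by simp) (by simp) rfl)
    · rcases lt_trichotomy a b with h | rfl | h
      · exact c6 a b h
      · exact c5 a
      · exact locNil_flip (c6 b a h) rfl rfl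
  have hlev : ∀ r : PIdx m n, 0 < level r := by
    rintro (a | a)
    · have := a.2
      simp only [level]
      omega
    · simp only [level]
      omega
  rcases i with r | ⟨⟩ | r <;> rcases j with s | ⟨⟩ | s
  · refine locNil_flip (cpos s r ?_) rfl rfl
    simp only [place] at hij ⊢
    omega
  · have := hlev r
    simp only [place] at hij
    omega
  · have := hlev r
    have := hlev s
    simp only [place] at hij
    omega
  · exact locNil_flip (czero s) rfl rfl
  · exact absurd hij (lt_irrefl _)
  · have := hlev s
    simp only [place] at hij
    omega
  · exact cbar r s
  · exact czero r
  · exact cpos r s hij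

end locNil

end OspModule
end OSP

/-! ### Finite dimension in terms of dominant coefficients. -/

namespace OSP

variable {m n : ℕ}

/-- The dominance conditions on the coefficients of a highest weight. -/
structure IsDominant (a : PIdx m n → ℤ) : Prop where
  half_nonneg : ∀ i, 0 ≤ a (Sum.inr i)
  half_mono : ∀ i i', i < i' → a (Sum.inr i) ≤ a (Sum.inr i')
  int_nonneg : ∀ j, 0 ≤ a (Sum.inl j)
  int_anti : ∀ j j', j < j' → a (Sum.inl j') ≤ a (Sum.inl j)
  hook : ∀ i : Fin n, (i : ℕ) = 0 → ∀ j : Fin m, a (Sum.inr i) ≤ (j : ℕ) → a (Sum.inl j) = 0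

theorem place_posIdx_pos (r : PIdx m n) : 0 < place (posIdx r) := by
  have := movedLevel_pos (m := m) (n := n) (Nat.zero_le m) r
  rw [← movedPlace_zero]
  exact this

theorem place_barIdx_neg (r : PIdx m n) : place (barIdx r) < 0 := by
  have := place_posIdx_pos r
  simp only [place] at this ⊢
  omega

namespace OspModule

variable {V : Type*} [AddCommGroup V] [Module ℂ V] {M : OspModule m n V} {w : Idx m n → ℂ}
  {u : V} {c : ZMod 2} {a : PIdx m n → ℤ}

/-- The sequence of coefficients at the integral labels. -/
def intCoeff (a : PIdx m n → ℤ) (k : ℕ) : ℤ := if h : k < m then a (Sum.inl ⟨k, h⟩) else 0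

theorem intCoeff_fin (a : PIdx m n → ℤ) (j : Fin m) : intCoeff a j = a (Sum.inl j) := by
  simp [intCoeff]

theorem IsIrreducible.isDominant_of_finiteDimensional [FiniteDimensional ℂ V]
    (hM : M.IsIrreducible) (hs : M.IsSing place u) (hw : M.IsWt w u) (hc : u ∈ M.part c)
    (h0 : u ≠ 0) (ha : ∀ r, w (barIdx r) = a r) : IsDominant a := by
  have hhalf : ∀ i, 0 ≤ a (Sum.inr i) := by
    intro i
    obtain ⟨N, hN⟩ := exists_nat_odd isOrder_place hs hw h0 (place_barIdx_neg (Sum.inr i)) rfl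
    rw [ha] at hN
    have : a (Sum.inr i) = N := by exact_mod_cast hN
    omega
  have hint : ∀ j, 0 ≤ a (Sum.inl j) := by
    intro j
    obtain ⟨N, hN⟩ := exists_nat_short isOrder_place hs hw h0 (place_barIdx_neg (Sum.inl j)) rfl
    rw [ha] at hN
    have h2 : (2 : ℂ) * a (Sum.inl j) = N := by rw [hN]; ring
    have : 2 * a (Sum.inl j) = N := by exact_mod_cast h2
    omega
  have hanti : ∀ j j', j < j' → a (Sum.inl j') ≤ a (Sum.inl j) := by
    intro j j' h
    obtain ⟨N, hN⟩ := exists_nat_long hs hw h0 (i := barIdx (Sum.inl j')) (j := barIdx (Sum.inl j))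
      (by
        have h : (j : ℕ) < j' := h
        simp only [place, level]
        omega) (by simp) (by simp) (by simp) rfl
    rw [ha, ha] at hN
    have : a (Sum.inl j) - a (Sum.inl j') = N := by exact_mod_cast hN
    omega
  refine ⟨hhalf, fun i i' h => ?_, hint, hanti, fun i hi j hj => ?_⟩
  · obtain ⟨N, hN⟩ := exists_nat_long hs hw h0 (i := barIdx (Sum.inr i)) (j := barIdx (Sum.inr i'))
      (by
        have h : (i : ℕ) < i' := h
        simp only [place, level]
        omega) (by simp) (by simp) (by simp) rfl
    rw [ha, ha] at hN
    have : a (Sum.inr i') - a (Sum.inr i) = N := by exact_mod_cast hN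
    omega
  -- The hook condition comes from nonnegativity at the label `1/2` for the singular vector of the
  -- fully reflected order.
  · have hn : 0 < n := by have := i.2; omega
    obtain rfl : i = ⟨0, hn⟩ := Fin.ext hi
    obtain ⟨u', c', w', h0', hc', hs', hw', hd, -⟩ := hM.exists_movedPlace_isSing hs hw hc h0 hn
      (ν := intCoeff a) (d := a (Sum.inr ⟨0, hn⟩))
      (by rw [← ha, ← dual_barIdx, hw.dual h0])
      (fun j => by rw [intCoeff_fin, ← ha, ← dual_barIdx, hw.dual h0]) le_rfl
    obtain ⟨N, hN⟩ := exists_nat_odd (isOrder_movedPlace le_rfl) hs' hw' h0'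
      (j := barIdx (Sum.inr ⟨0, hn⟩)) (by simp [movedPlace, movedLevel]) rfl
    rw [← dual_posIdx, hw'.dual h0', hd, neg_neg] at hN
    have hN : reflSeq (intCoeff a) (a (Sum.inr ⟨0, hn⟩)) m = N := by exact_mod_cast hN
    rw [← intCoeff_fin a j]
    refine eq_zero_of_reflSeq_nonneg (hhalf _) (m := m) ?_ ?_ (by omega) j.2 hj
    · intro k hk
      rw [intCoeff, dif_pos hk]
      exact hint _
    · intro k l hkl hl
      rw [intCoeff, intCoeff, dif_pos hl, dif_pos (by omega)]
      rcases hkl.eq_or_lt with rfl | h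
      · exact le_rfl
      · exact hanti _ _ (Fin.lt_def.2 h)

theorem IsIrreducible.finiteDimensional_of_isDominant
    (hM : M.IsIrreducible) (hs : M.IsSing place u) (hw : M.IsWt w u) (hc : u ∈ M.part c)
    (h0 : u ≠ 0) (ha : ∀ r, w (barIdx r) = a r) (hdom : IsDominant a) : FiniteDimensional ℂ V := by
  have hpos : ∀ r, w (posIdx r) = -(a r : ℂ) := fun r => by
    rw [← ha, ← dual_barIdx, hw.dual h0]
  have hlong : ∀ r s : PIdx m n, r ≠ s → pparity r = pparity s → a s ≤ a r →
      place (posIdx r) = place (posIdx s) + 1 → LocNil (M.T (posIdx r) (posIdx s)) := by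
    intro r s hrs hpar hle hpl
    refine hM.locNil_T isOrder_place (by omega) hpar h0 ⟨_, hM.pow_even_simple_eq_zero isOrder_place
      hs hw hc hpl (by simp) hpar (a r - a s).toNat ?_⟩
    rw [hpos, hpos, rootWt_long (by simpa using hrs) (by simp) (by simp) (by simp)]
    have h1 : ((a r - a s).toNat : ℤ) = a r - a s := Int.toNat_of_nonneg (by omega)
    have h2 : ((a r - a s).toNat : ℂ) = a r - a s := by exact_mod_cast congrArg (Int.cast : ℤ → ℂ) h1
    rw [h2]
    push_cast
    ring
  refine hM.finiteDimensional isOrder_place hc hw hs h0 (locNil_of_simple ?_ ?_ ?_ ?_)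
  · intro j j' h
    have hlt : j < j' := Fin.lt_def.2 (by omega)
    refine hlong _ _ (by simpa using hlt.ne) rfl (hdom.int_anti _ _ hlt) ?_
    simp only [place, level]
    omega
  · intro j h
    have hpl : place (posIdx (Sum.inl j) : Idx m n) = place (zeroIdx : Idx m n) + 1 := by
      simp only [place, level]
      omega
    -- The short root has `κ = 1`, hence the exponent parameter `2 a` instead of `a`.
    refine hM.locNil_T isOrder_place (by omega) rfl h0 ⟨_, hM.pow_even_simple_eq_zero isOrder_place
      hs hw hc hpl (by simp) rfl (2 * a (Sum.inl j)).toNat ?_⟩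
    rw [hpos, hw.zeroIdx h0, rootWt_short (by simp)]
    have h1 : ((2 * a (Sum.inl j)).toNat : ℤ) = 2 * a (Sum.inl j) :=
      Int.toNat_of_nonneg (by have := hdom.int_nonneg j; omega)
    have h2 : ((2 * a (Sum.inl j)).toNat : ℂ) = 2 * a (Sum.inl j) := by
      exact_mod_cast congrArg (Int.cast : ℤ → ℂ) h1
    rw [h2]
    push_cast
    ring
  · intro i i' h
    have hlt : i < i' := Fin.lt_def.2 (by omega)
    refine hlong _ _ (by simpa using hlt.ne') rfl (hdom.half_mono _ _ hlt) ?_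
    simp only [place, level]
    omega
  -- In the fully reflected order `-ε_{1/2}` is simple, so its lowering operator is nilpotent on the
  -- reflected vector `u'`, which is a nonzero vector of the same module.
  · intro i hi
    have hn : 0 < n := by have := i.2; omega
    obtain rfl : i = ⟨0, hn⟩ := Fin.ext hi
    obtain ⟨u', c', w', h0', hc', hs', hw', hd, -⟩ := hM.exists_movedPlace_isSing hs hw hc h0 hn
      (ν := intCoeff a) (d := a (Sum.inr ⟨0, hn⟩)) (hpos _)
      (fun j => by rw [intCoeff_fin, hpos]) le_rfl
    have hnn : 0 ≤ reflSeq (intCoeff a) (a (Sum.inr ⟨0, hn⟩)) m := by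
      refine reflSeq_nonneg (hdom.half_nonneg _) ?_ ?_
      · intro k hk
        rw [intCoeff, dif_pos hk]
        exact hdom.int_nonneg _
      · intro k hk h
        rw [intCoeff, dif_pos hk]
        exact hdom.hook _ rfl _ h
    obtain ⟨N, hN⟩ := Int.eq_ofNat_of_zero_le hnn
    set i : Idx m n := posIdx (Sum.inr ⟨0, hn⟩) with hidef
    have hpar : parity i = 1 := rfl
    have hz := hM.pow_odd_simple_eq_zero (isOrder_movedPlace le_rfl) hs' hw' hc' (i := i)
      (by simp [hidef, movedPlace, movedLevel]) hpar N (by rw [hd, hN]; simp)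
    -- `locNil_T` needs an even operator, so nilpotency is spread by the square and then brought
    -- back to the odd operator.
    have hsq : M.T i (dual i) = (-(flipSign i zeroIdx) * 2) • (M.T i zeroIdx ^ 2) := by
      ext v
      rw [LinearMap.smul_apply, pow_two, Module.End.mul_apply, ← smul_smul, M.T_sq_short' hpar,
        smul_smul, neg_mul_neg, flipSign_mul_self, one_smul]
    have hlt : place (dual i) < place i := by
      have h1 := place_barIdx_neg (Sum.inr ⟨0, hn⟩ : PIdx m n)
      have h2 := place_posIdx_pos (Sum.inr ⟨0, hn⟩ : PIdx m n)
      exact h1.trans h2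
    refine locNil_of_self_dual hpar (hM.locNil_T isOrder_place hlt (by rw [parity_dual]) h0'
      ⟨2 * N + 1, ?_⟩)
    rw [hsq, smul_pow, LinearMap.smul_apply, ← pow_mul, pow_apply_eq_zero_of_le (by omega) hz,
      smul_zero]

end OspModule

/-! ### Dominant coefficients and hook partitions. -/

theorem exists_youngDiagram {n m : ℕ} {d ν : ℕ → ℤ}
    (hd : ∀ r r', r ≤ r' → r' < n → d r' ≤ d r) (hd0 : ∀ r < n, 0 ≤ d r)
    (hν : ∀ c c', c ≤ c' → ν c' ≤ ν c) (hν0 : ∀ c, 0 ≤ ν c) (hνm : ∀ c, m ≤ c → ν c = 0)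
    (hook : ∀ r < n, ∀ c : ℕ, d r ≤ c → ν c = 0) :
    ∃ lam : YoungDiagram, (∀ r < n, (lam.rowLen r : ℤ) = d r) ∧
      (∀ c, max ((lam.colLen c : ℤ) - n) 0 = ν c) ∧ lam.rowLen n ≤ m := by
  classical
  -- The upper `n` rows are prescribed by `d`, and the columns below them by `ν`.
  let P : ℕ × ℕ → Prop := fun q => (q.1 < n ∧ (q.2 : ℤ) < d q.1) ∨ (n ≤ q.1 ∧ (q.1 : ℤ) - n < ν q.2)
  have hlow : ∀ q q' : ℕ × ℕ, q' ≤ q → P q → P q' := by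
    rintro ⟨r, c⟩ ⟨r', c'⟩ ⟨h1, h2⟩ h
    dsimp only at h1 h2
    rcases h with ⟨h3, h4⟩ | ⟨h3, h4⟩
    · have := hd r' r h1 h3
      left
      dsimp only at h3 h4 ⊢
      constructor <;> omega
    · dsimp only at h3 h4
      by_cases h5 : r' < n
      · left
        refine ⟨h5, ?_⟩
        dsimp only
        -- A box below row `n` in a column outside row `r'` would contradict `hook`; this is what
        -- makes the two pieces a lower set.
        by_contra h6
        have := hook r' h5 c (by omega)
        omega
      · right
        have := hν c' c h2
        dsimp only
        constructor <;> omega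
  have hbound : ∀ q, P q → q ∈ Finset.range (n + (ν 0).toNat) ×ˢ
      Finset.range (m + (d 0).toNat) := by
    rintro ⟨r, c⟩ h
    rw [Finset.mem_product, Finset.mem_range, Finset.mem_range]
    rcases h with ⟨h3, h4⟩ | ⟨h3, h4⟩
    · dsimp only at h3 h4 ⊢
      have := hd 0 r (Nat.zero_le _) h3
      constructor <;> omega
    · dsimp only at h3 h4 ⊢
      have := hν 0 c (Nat.zero_le _)
      refine ⟨by omega, ?_⟩
      by_contra h6
      have := hνm c (by omega)
      omega
  let lam : YoungDiagram := ⟨(Finset.range (n + (ν 0).toNat) ×ˢ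
      Finset.range (m + (d 0).toNat)).filter P, by
    intro q q' hle hq
    simp only [Finset.coe_filter, Set.mem_ofPred_eq] at hq ⊢
    have := hlow q q' hle hq.2
    exact ⟨hbound q' this, this⟩⟩
  have hmem : ∀ q, q ∈ lam ↔ P q := by
    intro q
    change q ∈ Finset.filter P _ ↔ _
    rw [Finset.mem_filter]
    exact ⟨fun h => h.2, fun h => ⟨hbound q h, h⟩⟩
  refine ⟨lam, fun r hr => ?_, fun c => ?_, ?_⟩
  · have : lam.rowLen r = (d r).toNat := by
      refine eq_of_forall_lt_iff fun c => ?_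
      rw [← YoungDiagram.mem_iff_lt_rowLen, hmem]
      simp only [P]
      omega
    rw [this]
    exact Int.toNat_of_nonneg (hd0 r hr)
  · have : lam.colLen c - n = (ν c).toNat := by
      refine eq_of_forall_lt_iff fun k => ?_
      have h : n + k < lam.colLen c ↔ P (n + k, c) := by
        rw [← YoungDiagram.mem_iff_lt_colLen, hmem]
      simp only [P] at h
      push_cast at h
      omega
    have := hν0 c
    omega
  · by_contra h
    have h : (n, m) ∈ lam := YoungDiagram.mem_iff_lt_rowLen.2 (by omega)
    rw [hmem] at h
    have := hνm m le_rfl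
    simp only [P] at h
    omega

/-- Dominant coefficients are those of the hook partitions. -/
theorem isDominant_iff_exists_youngDiagram {a : PIdx m n → ℤ} :
    IsDominant a ↔ ∃ lam : YoungDiagram, IsHookPartition n m lam ∧
      (∀ j : Fin m, a (Sum.inl j) = max ((lam.colLen j : ℤ) - (n : ℤ)) 0) ∧
      ∀ i : Fin n, a (Sum.inr i) = lam.rowLen (n - 1 - (i : ℕ)) := by
  constructor
  · intro h
    have hmono : ∀ i i', i ≤ i' → a (Sum.inr i) ≤ a (Sum.inr i') := fun i i' hi =>
      hi.eq_or_lt.elim (fun e => e ▸ le_rfl) (h.half_mono i i')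
    have hanti : ∀ i i', i ≤ i' → a (Sum.inl i') ≤ a (Sum.inl i) := fun i i' hi =>
      hi.eq_or_lt.elim (fun e => e ▸ le_rfl) (h.int_anti i i')
    obtain ⟨lam, h1, h2, h3⟩ := exists_youngDiagram (n := n) (m := m)
      -- Rows decrease while the half-integral coefficients increase with the label, hence the
      -- reversal `n - 1 - r`.
      (d := fun r => if hr : r < n then a (Sum.inr ⟨n - 1 - r, by omega⟩) else 0)
      (ν := OspModule.intCoeff a) (by
        intro r r' hr hr'
        simp only [hr', show r < n by omega, dif_pos]
        exact hmono _ _ (Fin.le_def.2 (by simp only; omega))) (by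
        intro r hr
        simp only [hr, dif_pos]
        exact h.half_nonneg _) (by
        intro k l hkl
        by_cases hl : l < m
        · rw [OspModule.intCoeff, OspModule.intCoeff, dif_pos hl, dif_pos (by omega)]
          exact hanti _ _ (Fin.le_def.2 hkl)
        · rw [OspModule.intCoeff, OspModule.intCoeff, dif_neg hl]
          split_ifs
          · exact h.int_nonneg _
          · exact le_rfl) (by
        intro k
        rw [OspModule.intCoeff]
        split_ifs
        · exact h.int_nonneg _
        · exact le_rfl) (by
        intro k hk
        rw [OspModule.intCoeff, dif_neg (by omega)]) (by
        intro r hr k hk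
        simp only [hr, dif_pos] at hk
        rw [OspModule.intCoeff]
        split_ifs with hkm
        · refine h.hook ⟨0, by omega⟩ rfl _ ?_
          exact (hmono _ _ (Fin.le_def.2 (Nat.zero_le _))).trans hk
        · rfl)
    refine ⟨lam, h3, fun j => ?_, fun i => ?_⟩
    · rw [h2, OspModule.intCoeff_fin]
    · have hi := i.2
      rw [h1 _ (by omega), dif_pos (by omega)]
      congr 2
      apply Fin.ext
      simp only
      omega
  · rintro ⟨lam, h1, h2, h3⟩
    refine ⟨fun i => ?_, fun i i' h => ?_, fun j => ?_, fun j j' h => ?_, fun i hi j hj => ?_⟩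
    · rw [h3]
      omega
    · rw [h3, h3]
      have : (i : ℕ) < i' := h
      exact_mod_cast lam.rowLen_anti _ _ (by omega)
    · rw [h2]
      exact le_max_right _ _
    · rw [h2, h2]
      have : lam.colLen j' ≤ lam.colLen j := lam.colLen_anti _ _ (le_of_lt h)
      omega
    · rw [h3, hi] at hj
      rw [h2]
      have hni := i.2
      -- Row `n - 1`, counted from 0, is too short to reach column `j`, so this column stops before
      -- row `n`.
      have h4 : ¬ (n - 1 < lam.colLen j) := by
        rw [← YoungDiagram.mem_iff_lt_colLen, YoungDiagram.mem_iff_lt_rowLen]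
        simp only [Nat.sub_zero] at hj
        omega
      omega

/-! ### Weights in coordinates and homogeneous highest weight vectors. -/

/-- The basis of the Cartan subalgebra dual to the weights `eps`. -/
def coroot (k : Idx m n) : cartan m n :=
  ⟨⟨rootMatrix k k, rootMatrix_mem k k⟩, by
    intro i j hij
    simp only [rootMatrix, Matrix.sub_apply, Matrix.smul_apply, Matrix.single_apply]
    rw [if_neg (by rintro ⟨rfl, rfl⟩; exact hij rfl), if_neg (by rintro ⟨rfl, rfl⟩; exact hij rfl)]
    simp⟩

theorem eps_coroot (r s : PIdx m n) : eps r (coroot (posIdx s)) = if r = s then 1 else 0 := by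
  change rootMatrix (posIdx s) (posIdx s) (posIdx r) (posIdx r) = _
  simp [rootMatrix, Matrix.single_apply, eq_comm]

theorem rootMatrix_mem_nilradical {i j : Idx m n} (hij : place i < place j) :
    (⟨rootMatrix i j, rootMatrix_mem i j⟩ : osp m n) ∈ nilradical m n := by
  intro a b hab
  have h1 := isOrder_place.anti i
  have h2 := isOrder_place.anti j
  simp only [rootMatrix, Matrix.sub_apply, Matrix.smul_apply, Matrix.single_apply]
  rw [if_neg (by rintro ⟨rfl, rfl⟩; exact hab hij),
    if_neg (by rintro ⟨rfl, rfl⟩; exact hab (by omega))]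
  simp

/-- In a diagonal element of `osp` the barred entries are the negatives of the unbarred ones and the
middle entry is its own negative, so the unbarred entries determine it. -/
theorem eq_sum_coroot (x : cartan m n) : x = ∑ r : PIdx m n, eps r x • coroot (posIdx r) := by
  apply Subtype.ext
  apply Subtype.ext
  have h1 : ((∑ r : PIdx m n, eps r x • coroot (posIdx r) : cartan m n) : osp m n).1
      = ∑ r : PIdx m n, x.1.1 (posIdx r) (posIdx r) • rootMatrix (posIdx r) (posIdx r) := by
    simp only [Submodule.coe_sum, Submodule.coe_smul]
    rfl
  rw [h1]
  ext i j
  have hx := mem_osp_iff.1 x.1.2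
  rw [Matrix.sum_apply]
  simp only [Matrix.smul_apply, rootMatrix, Matrix.sub_apply, Matrix.single_apply, flipSign_self,
    smul_eq_mul, dual_posIdx]
  by_cases hij : i = j
  · subst hij
    rcases i with r | ⟨⟩ | r
    · have := hx (Sum.inl r) (Sum.inl r)
      rw [flipSign_self] at this
      simp only [dual] at this
      simp [this]
    · have := hx zeroIdx zeroIdx
      rw [flipSign_self, dual_zeroIdx] at this
      have h0 : x.1.1 (zeroIdx : Idx m n) zeroIdx = 0 := by linear_combination this / 2
      simpa using h0
    · simp
  · rw [x.2 i j hij]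
    symm
    refine Finset.sum_eq_zero fun r _ => ?_
    rw [if_neg (by rintro ⟨rfl, rfl⟩; exact hij rfl),
      if_neg (by rintro ⟨rfl, rfl⟩; exact hij rfl)]
    simp

theorem dual_ext {μ μ' : Module.Dual ℂ (cartan m n)}
    (h : ∀ r, μ (coroot (posIdx r)) = μ' (coroot (posIdx r))) : μ = μ' := by
  ext x
  rw [eq_sum_coroot x]
  simp [h]

theorem IsIntegralWeight.exists_int {μ : Module.Dual ℂ (cartan m n)} (h : IsIntegralWeight μ)
    (r : PIdx m n) : ∃ a : ℤ, μ (coroot (posIdx r)) = -(a : ℂ) := by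
  induction h using AddSubgroup.closure_induction with
  | mem x hx =>
    obtain ⟨s, rfl⟩ := hx
    rw [eps_coroot]
    split_ifs
    · exact ⟨-1, by simp⟩
    · exact ⟨0, by simp⟩
  | zero => exact ⟨0, by simp⟩
  | add x y _ _ hx hy =>
    obtain ⟨a, ha⟩ := hx
    obtain ⟨b, hb⟩ := hy
    exact ⟨a + b, by rw [LinearMap.add_apply, ha, hb]; push_cast; ring⟩
  | neg x _ hx =>
    obtain ⟨a, ha⟩ := hx
    exact ⟨-a, by rw [LinearMap.neg_apply, ha]; push_cast; ring⟩

theorem hookWeight_coroot_inl (lam : YoungDiagram) (j : Fin m) :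
    hookWeight m n lam (coroot (posIdx (Sum.inl j))) =
      -((max ((lam.colLen j : ℤ) - (n : ℤ)) 0 : ℤ) : ℂ) := by
  simp only [hookWeight, LinearMap.sub_apply, LinearMap.neg_apply, LinearMap.sum_apply,
    LinearMap.smul_apply, eps_coroot, epsInt, epsHalf]
  simp

theorem hookWeight_coroot_inr (lam : YoungDiagram) (i : Fin n) :
    hookWeight m n lam (coroot (posIdx (Sum.inr i))) =
      -((lam.rowLen (n - 1 - (i : ℕ)) : ℤ) : ℂ) := by
  simp only [hookWeight, LinearMap.sub_apply, LinearMap.neg_apply, LinearMap.sum_apply,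
    LinearMap.smul_apply, eps_coroot, epsInt, epsHalf]
  simp

theorem eq_hookWeight_iff {μ : Module.Dual ℂ (cartan m n)} {a : PIdx m n → ℤ}
    (ha : ∀ r, μ (coroot (posIdx r)) = -(a r : ℂ)) (lam : YoungDiagram) :
    μ = hookWeight m n lam ↔ (∀ j : Fin m, a (Sum.inl j) = max ((lam.colLen j : ℤ) - (n : ℤ)) 0) ∧
      ∀ i : Fin n, a (Sum.inr i) = lam.rowLen (n - 1 - (i : ℕ)) := by
  constructor
  · rintro rfl
    refine ⟨fun j => ?_, fun i => ?_⟩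
    · have := ha (Sum.inl j)
      rw [hookWeight_coroot_inl, neg_inj, Int.cast_inj] at this
      exact this.symm
    · have := ha (Sum.inr i)
      rw [hookWeight_coroot_inr, neg_inj, Int.cast_inj] at this
      exact this.symm
  · rintro ⟨h1, h2⟩
    refine dual_ext ?_
    rintro (j | i)
    · rw [ha, hookWeight_coroot_inl, h1]
    · rw [ha, hookWeight_coroot_inr, h2]

/-- A highest weight vector can be chosen homogeneous. -/
theorem OspModule.HasHighestWeight.exists_homogeneous {V : Type*} [AddCommGroup V] [Module ℂ V]
    {M : OspModule m n V} {μ : Module.Dual ℂ (cartan m n)} (h : M.HasHighestWeight μ) :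
    ∃ (u : V) (c : ZMod 2), u ≠ 0 ∧ u ∈ M.part c ∧ M.IsSing place u ∧
      M.IsWt (fun k => μ (coroot k)) u := by
  obtain ⟨v, hv0, hv1, hv2⟩ := h
  have htop : v ∈ M.part 0 ⊔ M.part 1 := by
    rw [M.isCompl.sup_eq_top]
    trivial
  obtain ⟨v0, h0, v1, h1, rfl⟩ := Submodule.mem_sup.1 htop
  -- Root vectors are homogeneous, so every equation satisfied by the highest weight vector splits
  -- into equations for its even and odd components.
  have hsplit : ∀ (c : ZMod 2) (x y : V), x ∈ M.part (c + 0) → y ∈ M.part (c + 1) → x + y = 0 →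
      x = 0 ∧ y = 0 := by
    intro c x y hx hy hxy
    have hx0 : x = 0 := by
      have hc : ∀ c : ZMod 2, c = 0 ∨ c = 1 := by decide
      have hxy' : x = -y := eq_neg_of_add_eq_zero_left hxy
      have h11 : (1 + 1 : ZMod 2) = 0 := by decide
      rcases hc c with rfl | rfl
      · refine Submodule.disjoint_def.1 M.isCompl.disjoint x (by simpa using hx) ?_
        rw [hxy']
        exact Submodule.neg_mem _ (by simpa using hy)
      · refine Submodule.disjoint_def.1 M.isCompl.disjoint x ?_ (by simpa using hx)
        rw [hxy']
        rw [h11] at hy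
        exact Submodule.neg_mem _ hy
    subst hx0
    exact ⟨rfl, by simpa using hxy⟩
  have hs : ∀ i j, place i < place j → M.T i j v0 = 0 ∧ M.T i j v1 = 0 := by
    intro i j hij
    refine hsplit (parity i + parity j) _ _ (M.T_mem_part i j h0) (M.T_mem_part i j h1) ?_
    rw [← map_add]
    exact hv1 _ (rootMatrix_mem_nilradical hij)
  have hw : ∀ k, M.T k k v0 - μ (coroot k) • v0 = 0 ∧ M.T k k v1 - μ (coroot k) • v1 = 0 := by
    intro k
    have hk : ∀ a : ZMod 2, parity k + parity k + a = a := by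
      intro a
      rw [OspModule.zmod_two_add_self, zero_add]
    refine hsplit 0 _ _ ?_ ?_ ?_
    · refine Submodule.sub_mem _ ?_ (Submodule.smul_mem _ _ (by simpa using h0))
      have := M.T_mem_part k k h0
      rwa [hk, ← zero_add (0 : ZMod 2)] at this
    · refine Submodule.sub_mem _ ?_ (Submodule.smul_mem _ _ (by simpa using h1))
      have := M.T_mem_part k k h1
      rwa [hk, ← zero_add (1 : ZMod 2)] at this
    · have := hv2 (coroot k)
      have e : M.T k k (v0 + v1) = μ (coroot k) • (v0 + v1) := this
      rw [map_add, smul_add] at e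
      rw [sub_add_sub_comm, e, sub_self]
  by_cases hz : v0 = 0
  · refine ⟨v1, 1, ?_, h1, fun i j hij => (hs i j hij).2, fun k => sub_eq_zero.1 (hw k).2⟩
    rintro rfl
    exact hv0 (by rw [hz, add_zero])
  · exact ⟨v0, 0, hz, h0, fun i j hij => (hs i j hij).1, fun k => sub_eq_zero.1 (hw k).1⟩

end OSP

theorem mainTheorem9 (m n : ℕ) {V : Type*} [AddCommGroup V] [Module ℂ V]
    (M : OSP.OspModule m n V) (hirr : M.IsIrreducible)
    (μ : Module.Dual ℂ (OSP.cartan m n)) (hint : OSP.IsIntegralWeight μ)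
    (hhw : M.HasHighestWeight μ) :
    FiniteDimensional ℂ V ↔
      ∃ lam : YoungDiagram, OSP.IsHookPartition n m lam ∧ μ = OSP.hookWeight m n lam := by
  obtain ⟨u, c, h0, hc, hs, hw⟩ := hhw.exists_homogeneous
  -- `a r` is minus the coefficient of `ε_r`, the sign for which dominance means nonnegativity.
  choose a ha using hint.exists_int
  have hbar : ∀ r, μ (OSP.coroot (OSP.barIdx r)) = a r := fun r => by
    have := hw.dual h0 (OSP.posIdx r)
    rw [OSP.dual_posIdx] at this
    rw [this, ha, neg_neg]
  have hiff : (∃ lam : YoungDiagram, OSP.IsHookPartition n m lam ∧ μ = OSP.hookWeight m n lam) ↔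
      OSP.IsDominant a := by
    rw [OSP.isDominant_iff_exists_youngDiagram]
    exact exists_congr fun lam => and_congr_right fun _ => OSP.eq_hookWeight_iff ha lam
  rw [hiff]
  exact ⟨fun _ => hirr.isDominant_of_finiteDimensional hs hw hc h0 hbar,
    fun h => hirr.finiteDimensional_of_isDominant hs hw hc h0 hbar h⟩
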